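/- Fix $\varepsilon>0$, an integer $n\ge 4$ and an odd prime $p$. For a diagonal quadratic form $Q(x_1,\dots,x_n)=\lambda_1x_1^2+\cdots+\lambda_nx_n^2$ with integer coefficients put $A_p(Q)=\#\mathcal A(Q)/p^{n-1}$, where $\mathcal A(Q)$ is the set of $(x_1,\dots,x_n)\in\mathbb Z^n$ with $0\le x_1,\dots,x_n\le p-1$, $(x_1,\dots,x_n)\ne(0,\dots,0)$ and $Q(x_1,\dots,x_n)\equiv 0\bmod p$. Let $\Phi:\mathbb R\to\mathbb R_{\ge 0}$ be a Schwartz function, with Fourier transform $\hat\Phi(y)=\int_{\mathbb R}\Phi(x)e^{-2\pi i xy}\,dx$. Write $q=p^m$. Then, as $m\to\infty$, $$ \sum_{\substack{(x_1,\dots,x_n)\in\mathbb Z^n\\ (x_1,\dots,x_n)\not\equiv(0,\dots,0)\bmod p\\ Q(x_1,\dots,x_n)\equiv 0\bmod q}}\ \prod_{i=1}^n\Phi\!\left(\frac{x_i}{N}\right)\ \sim\ A_p(Q)\cdot\hat\Phi(0)^n\cdot\frac{N^n}{q}, $$ uniformly in all integer coefficients $\lambda_1,\dots,\lambda_n$ with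 $(\lambda_1\cdots\lambda_n,p)=1$ (which may vary with $m$) and in all real $N\ge q^{1/2+\varepsilon}$. That is, for every $\delta>0$ there is an $m_0$ depending only on $\varepsilon,n,p,\Phi,\delta$ such that for all $m\ge m_0$, all such coefficients and all such $N$, the sum converges and differs from the right-hand side by at most $\delta$ times the right-hand side. In particular, there is an $m_0$ depending only on $\varepsilon,n,p$ such that for all $m\ge m_0$ and all integers $\lambda_1,\dots,\lambda_n$ with $(\lambda_1\cdots\lambda_n,p)=1$, the congruence $Q(x_1,\dots,x_n)\equiv 0\bmod q$ has a solution $(x_1,\dots,x_n)\in\mathbb Z^n$ with $(x_1,\dots,x_n)\not\equiv(0,\dots,0)\bmod p$ and $\max\{|x_1|,\dots,|x_n|\}\le q^{1/2+\varepsilon}$. -/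

import Mathlib

open scoped FourierTransform SchwartzMap

/-- The diagonal quadratic form `Q(x) = c₁ x₁² + ⋯ + cₙ xₙ²` with integer coefficients. -/
def diagForm {n : ℕ} (c x : Fin n → ℤ) : ℤ := ∑ i, c i * x i ^ 2

/-- The set of nonzero `x` with `0 ≤ xᵢ ≤ p - 1` for all `i` and `Q(x) ≡ 0 mod p`. -/
noncomputable def solutionsModP {n : ℕ} (p : ℕ) (c : Fin n → ℤ) : Finset (Fin n → ℤ) :=
  (Fintype.piFinset fun _ => Finset.Icc (0 : ℤ) ((p : ℤ) - 1)).filter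
    fun x => x ≠ 0 ∧ diagForm c x ≡ 0 [ZMOD p]

/-- The density `A_p(Q)`: the number of nonzero solutions modulo `p`, divided by `p^(n-1)`. -/
noncomputable def solutionDensity {n : ℕ} (p : ℕ) (c : Fin n → ℤ) : ℝ :=
  ((solutionsModP p c).card : ℝ) / (p : ℝ) ^ (n - 1)

/-- The integer vectors `x` with `x ≢ 0 mod p` (not all coordinates divisible by `p`) and
`Q(x) ≡ 0 mod p^m`. -/
def congruenceSolutions {n : ℕ} (p m : ℕ) (c : Fin n → ℤ) : Set (Fin n → ℤ) :=
  {x | ¬ (∀ i, x i ≡ 0 [ZMOD p]) ∧ diagForm c x ≡ 0 [ZMOD (p : ℤ) ^ m]}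

/-- The weight `∏ᵢ Φ(xᵢ / N)` of an integer vector `x`. -/
noncomputable def boxWeight {n : ℕ} (Φ : 𝓢(ℝ, ℝ)) (N : ℝ) (x : Fin n → ℤ) : ℝ :=
  ∏ i, Φ ((x i : ℝ) / N)

/-- The weighted count of the solutions in `congruenceSolutions p m c`. -/
noncomputable def weightedCount {n : ℕ} (p m : ℕ) (c : Fin n → ℤ) (Φ : 𝓢(ℝ, ℝ)) (N : ℝ) : ℝ :=
  ∑' x : congruenceSolutions p m c, boxWeight Φ N x.1

/-- The main term `A_p(Q) · Φ̂(0)^n · N^n / p^m`, where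
`Φ̂(y) = ∫ Φ(x) exp(-2πixy) dx` is the Fourier transform of `Φ`. -/
noncomputable def mainTerm {n : ℕ} (p m : ℕ) (c : Fin n → ℤ) (Φ : 𝓢(ℝ, ℝ)) (N : ℝ) : ℂ :=
  (solutionDensity p c : ℂ) * (𝓕 (fun x : ℝ => (Φ x : ℂ)) 0) ^ n * ((N : ℂ) ^ n / (p : ℂ) ^ m)

/-! Detect residue classes modulo `q = p ^ m` by additive characters and apply Poisson summation in
each coordinate (`weightedCount_eq_sum`). The count becomes `(N / q) ^ n` times a sum over dual
frequencies `b` modulo `q` of a smooth weight times the exponential sum `diagSum` over the primitive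
zeros. As `N ≥ q ^ (1/2 + ε)`, the weight is negligible unless every coordinate of `b` is at most `q
^ (1/2 - ε/2)`. Frequency zero gives the main term: Hensel lifting (`card_lifts`) makes `diagSum`
there `q ^ (n-1)` up to a factor bounded above and below in terms of `p` and `n`.

At a frequency not divisible by `p`, `diagSum` is an average over units `t` of products of Gauss
sums. This gives size `O(q ^ (n/2))`. After completing the squares, the remaining product is
unchanged when `t` is multiplied by a square, in particular by any `1 + p * s`; averaging over `s`
makes the sum vanish unless `q / p` divides the dual form `∑ b i ^ 2 / (4 * c i)`
(`norm_primSum_le_of_primitive`). Frequencies exactly divisible by `p ^ ν` reduce to modulus `q / p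
^ ν` (`diagSum_prime_pow_mul`).

It remains to count zeros of the dual form in a box of side `Y`, with `Y ^ 2` at most a constant
times the modulus. Four variables suffice for the bound `Y ^ (n-2+o(1))` (`card_diag_zmod_le`),
uniformly in the coefficients: a coincidence count is at most the mean of two self-coincidence
counts, where unit coefficients cancel, so everything reduces to the additive energy of integer
squares and the divisor bound. Since `n/2 + (n-2)/2 = n-1`, the nonzero frequencies lose a power of
`q` against the main term. -/

/-! ### Divisor bound and additive energy of squares. -/

-- The divisor function is multiplicative. At primes `q ≥ 2 ^ (1/η)` the factor `a + 1 ≤ 2 ^ a` is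
-- already at most `q ^ (a * η)`; each of the fewer than `P` smaller primes costs at most a constant
-- `K`.
open Finset in
theorem card_divisors_le_rpow {η : ℝ} (hη : 0 < η) :
    ∃ C : ℝ, 0 < C ∧ ∀ n : ℕ, n ≠ 0 → (#n.divisors : ℝ) ≤ C * (n : ℝ) ^ η := by
  set K : ℝ := 1 + 1 / (η * Real.log 2)
  have hl : 0 < Real.log 2 := Real.log_pos one_lt_two
  have hK : 1 ≤ K := le_add_of_nonneg_right (by positivity)
  obtain ⟨P, hP⟩ := exists_nat_gt ((2 : ℝ) ^ (1 / η))
  refine ⟨K ^ P, by positivity, fun n hn => ?_⟩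
  have key : ∀ q a : ℕ, q.Prime →
      ((a : ℝ) + 1) ≤ (if q < P then K else 1) * ((q : ℝ) ^ a) ^ η := by
    intro q a hq
    have hq2 : (2 : ℝ) ≤ q := by exact_mod_cast hq.two_le
    have hqa : ((q : ℝ) ^ a) ^ η = ((q : ℝ) ^ η) ^ a := by
      rw [← Real.rpow_natCast, ← Real.rpow_natCast, ← Real.rpow_mul (by positivity),
        ← Real.rpow_mul (by positivity), mul_comm]
    split_ifs with h
    · have h1 : (2 : ℝ) ^ η ≤ (q : ℝ) ^ η := Real.rpow_le_rpow (by norm_num) hq2 hη.le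
      have h2 : 1 + (a : ℝ) * (η * Real.log 2) ≤ ((q : ℝ) ^ η) ^ a := by
        calc 1 + (a : ℝ) * (η * Real.log 2)
            ≤ Real.exp (a * (η * Real.log 2)) := by
              linarith [Real.add_one_le_exp ((a : ℝ) * (η * Real.log 2))]
          _ = ((2 : ℝ) ^ η) ^ a := by
              rw [Real.rpow_def_of_pos (by norm_num), ← Real.exp_nat_mul]; ring_nf
          _ ≤ _ := by gcongr
      rw [hqa]
      have h3 : (a : ℝ) + 1 ≤ K * (1 + (a : ℝ) * (η * Real.log 2)) := by
        have : K * (1 + (a : ℝ) * (η * Real.log 2))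
            = 1 + a * (η * Real.log 2) + 1 / (η * Real.log 2) + a := by
          simp only [K]; field_simp; ring
        rw [this]
        have : 0 ≤ (a : ℝ) * (η * Real.log 2) + 1 / (η * Real.log 2) := by positivity
        linarith
      exact h3.trans (by gcongr)
    · rw [hqa, one_mul]
      have h1 : (2 : ℝ) ≤ (q : ℝ) ^ η := by
        have : (2 : ℝ) ^ (1 / η) ≤ q := hP.le.trans (by exact_mod_cast not_lt.mp h)
        calc (2 : ℝ) = ((2 : ℝ) ^ (1 / η)) ^ η := by
              rw [← Real.rpow_mul (by norm_num), one_div_mul_cancel hη.ne', Real.rpow_one]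
          _ ≤ _ := Real.rpow_le_rpow (by positivity) this hη.le
      calc (a : ℝ) + 1 ≤ 2 ^ a := by exact_mod_cast Nat.lt_two_pow_self (n := a)
        _ ≤ _ := by gcongr
  have hn' : (n : ℝ) ^ η = ∏ q ∈ n.primeFactors, ((q : ℝ) ^ n.factorization q) ^ η := by
    rw [Real.finsetProd_rpow _ _ (fun i _ => by positivity)]
    congr 1
    conv_lhs => rw [← Nat.prod_factorization_pow_eq_self hn]
    rw [Finsupp.prod, Nat.support_factorization]
    push_cast
    rfl
  rw [Nat.card_divisors hn, hn']
  push_cast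
  calc ∏ q ∈ n.primeFactors, ((n.factorization q : ℝ) + 1)
      ≤ ∏ q ∈ n.primeFactors, ((if q < P then K else 1) * ((q : ℝ) ^ n.factorization q) ^ η) :=
        prod_le_prod (fun _ _ => by positivity)
          fun q hq => key q _ (Nat.prime_of_mem_primeFactors hq)
    _ = (∏ q ∈ n.primeFactors, (if q < P then K else 1)) *
          ∏ q ∈ n.primeFactors, ((q : ℝ) ^ n.factorization q) ^ η := prod_mul_distrib
    _ ≤ _ := by
        gcongr
        rw [← prod_filter, prod_const]
        refine pow_le_pow_right₀ hK ?_
        calc _ ≤ #(range P) := card_le_card fun q hq => by simpa using (mem_filter.mp hq).2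
          _ = P := card_range P

open Finset in
/-- The number of coincidences of two functions is at most the mean of the numbers of
self-coincidences. -/
theorem two_mul_card_coincidences_le {α X : Type*} [DecidableEq α] [DecidableEq X]
    (P : Finset α) (F G : α → X) :
    2 * #{u ∈ P ×ˢ P | F u.1 = G u.2} ≤
      #{u ∈ P ×ˢ P | F u.1 = F u.2} + #{u ∈ P ×ˢ P | G u.1 = G u.2} := by
  -- Coincidences are sums of products of fibre sizes over the common values; the claim is then `2ab
  -- ≤ a² + b²` fibre by fibre.
  have key : ∀ A B : α → X, (∀ a ∈ P, A a ∈ P.image F ∪ P.image G) →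
      #{u ∈ P ×ˢ P | A u.1 = B u.2} =
        ∑ x ∈ P.image F ∪ P.image G, #{u ∈ P | A u = x} * #{u ∈ P | B u = x} := by
    intro A B hA
    rw [card_eq_sum_card_fiberwise (f := fun u : α × α => A u.1) (t := P.image F ∪ P.image G)]
    · refine sum_congr rfl fun x _ => ?_
      rw [← card_product]
      congr 1
      ext ⟨a, b⟩
      simp only [mem_filter, mem_product]
      constructor
      · rintro ⟨⟨⟨ha, hb⟩, h⟩, rfl⟩; exact ⟨⟨ha, rfl⟩, hb, h.symm⟩
      · rintro ⟨⟨ha, rfl⟩, hb, h⟩; exact ⟨⟨⟨ha, hb⟩, h.symm⟩, rfl⟩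
    · rintro ⟨a, b⟩ h
      simp only [coe_filter, Set.mem_ofPred_eq, mem_product] at h
      exact hA a h.1.1
  have hF : ∀ a ∈ P, F a ∈ P.image F ∪ P.image G := fun a ha =>
    mem_union_left _ (mem_image_of_mem _ ha)
  have hG : ∀ a ∈ P, G a ∈ P.image F ∪ P.image G := fun a ha =>
    mem_union_right _ (mem_image_of_mem _ ha)
  rw [key F G hF, key F F hF, key G G hG, mul_sum, ← sum_add_distrib]
  refine sum_le_sum fun x _ => ?_
  nlinarith [sq_nonneg ((#{u ∈ P | F u = x} : ℤ) - #{u ∈ P | G u = x})]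

-- The difference `u.1 - u.2` is a divisor of `s`, up to sign, and determines the pair, because the
-- cofactor `u.1 + u.2` is then known.
open Finset in
theorem card_sq_sub_sq_le (Y : ℕ) {s : ℤ} (hs : s ≠ 0) :
    #{u ∈ Icc (-(Y : ℤ)) Y ×ˢ Icc (-(Y : ℤ)) Y | u.1 ^ 2 - u.2 ^ 2 = s} ≤
      2 * #s.natAbs.divisors := by
  set D : Finset ℤ := s.natAbs.divisors.image (fun d : ℕ => (d : ℤ)) ∪
    s.natAbs.divisors.image (fun d : ℕ => -(d : ℤ))
  have hD : #D ≤ 2 * #s.natAbs.divisors := by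
    refine (card_union_le _ _).trans ?_
    rw [two_mul]
    exact add_le_add card_image_le card_image_le
  refine le_trans (card_le_card_of_injOn (fun u => u.1 - u.2) ?_ ?_) hD
  · rintro ⟨a, c⟩ h
    simp only [coe_filter, Set.mem_ofPred_eq] at h
    have hd : a - c ∣ s := ⟨a + c, by rw [← h.2]; ring⟩
    have hm : (a - c).natAbs ∈ s.natAbs.divisors :=
      Nat.mem_divisors.mpr ⟨Int.natAbs_dvd_natAbs.mpr hd, Int.natAbs_ne_zero.mpr hs⟩
    simp only [D, coe_union, coe_image, Set.mem_union, Set.mem_image, mem_coe]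
    rcases le_total 0 (a - c) with h0 | h0
    · exact Or.inl ⟨_, hm, Int.natAbs_of_nonneg h0⟩
    · exact Or.inr ⟨_, hm, by omega⟩
  · rintro ⟨a, c⟩ h ⟨a', c'⟩ h' e
    simp only [coe_filter, Set.mem_ofPred_eq] at h h' e
    have h0 : a - c ≠ 0 := by
      intro h0
      apply hs
      rw [← h.2, show a = c by omega]; ring
    have h1 : (a - c) * (a + c) = (a - c) * (a' + c') := by
      calc (a - c) * (a + c) = s := by rw [← h.2]; ring
        _ = (a' - c') * (a' + c') := by rw [← h'.2]; ring
        _ = _ := by rw [e]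
    have h2 := mul_left_cancel₀ h0 h1
    ext <;> simp <;> omega

open Finset in
theorem card_sq_eq_sq_le (Y : ℕ) :
    #{u ∈ Icc (-(Y : ℤ)) Y ×ˢ Icc (-(Y : ℤ)) Y | u.1 ^ 2 - u.2 ^ 2 = 0} ≤ 2 * (2 * Y + 1) := by
  have h : {u ∈ Icc (-(Y : ℤ)) Y ×ˢ Icc (-(Y : ℤ)) Y | u.1 ^ 2 - u.2 ^ 2 = 0} ⊆
      (Icc (-(Y : ℤ)) Y).image (fun a => (a, a)) ∪ (Icc (-(Y : ℤ)) Y).image (fun a => (a, -a)) := by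
    rintro ⟨a, c⟩ h
    simp only [mem_filter, mem_product] at h
    simp only [mem_union, mem_image, Prod.mk.injEq]
    rcases sq_eq_sq_iff_eq_or_eq_neg.mp (sub_eq_zero.mp h.2) with e | e
    · exact Or.inl ⟨a, h.1.1, rfl, e⟩
    · exact Or.inr ⟨a, h.1.1, rfl, by omega⟩
  refine (card_le_card h).trans ((card_union_le _ _).trans ?_)
  have hI : #(Icc (-(Y : ℤ)) Y) = 2 * Y + 1 := by rw [Int.card_Icc]; omega
  rw [two_mul]
  exact add_le_add (card_image_le.trans hI.le) (card_image_le.trans hI.le)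

open Finset in
/-- The additive energy of the squares up to `Y ^ 2`. -/
theorem card_energy_int_le {η : ℝ} (hη : 0 < η) : ∃ C : ℝ, 0 < C ∧ ∀ Y : ℕ, 1 ≤ Y →
    (#{u ∈ (Icc (-(Y : ℤ)) Y ×ˢ Icc (-(Y : ℤ)) Y) ×ˢ (Icc (-(Y : ℤ)) Y ×ˢ Icc (-(Y : ℤ)) Y) |
      u.1.1 ^ 2 - u.1.2 ^ 2 = u.2.1 ^ 2 - u.2.2 ^ 2} : ℝ) ≤ C * (Y : ℝ) ^ 2 * (Y : ℝ) ^ η := by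
  -- The differences are as large as `Y ^ 2`, so exponent `η / 2` in the divisor bound becomes `η`
  -- in terms of `Y`.
  obtain ⟨C, hC, hd⟩ := card_divisors_le_rpow (half_pos hη)
  refine ⟨36 + 18 * C, by positivity, fun Y hY => ?_⟩
  set I := Icc (-(Y : ℤ)) Y with hI
  have hIc : #I = 2 * Y + 1 := by rw [hI, Int.card_Icc]; omega
  have hY1 : (1 : ℝ) ≤ Y := by exact_mod_cast hY
  have hYη : (1 : ℝ) ≤ (Y : ℝ) ^ η := Real.one_le_rpow hY1 hη.le
  set P := I ×ˢ I
  set h : ℤ × ℤ → ℤ := fun u => u.1 ^ 2 - u.2 ^ 2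
  set Z := P.filter fun u => h u = 0
  have hZ : (#Z : ℝ) ≤ 6 * Y := by
    have : #Z ≤ 2 * (2 * Y + 1) := card_sq_eq_sq_le Y
    have : (#Z : ℝ) ≤ 2 * (2 * Y + 1) := by exact_mod_cast this
    linarith
  have hfib : ∀ v ∈ P, h v ≠ 0 → (#{u ∈ P | h u = h v} : ℝ) ≤ 2 * C * (Y : ℝ) ^ η := by
    rintro ⟨a, c⟩ hv h0
    have h1 : #{u ∈ P | h u = h (a, c)} ≤ 2 * #(h (a, c)).natAbs.divisors := card_sq_sub_sq_le Y h0
    have h2 := hd _ (Int.natAbs_ne_zero.mpr h0)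
    have h3 : ((h (a, c)).natAbs : ℝ) ≤ (Y : ℝ) ^ 2 := by
      have : |h (a, c)| ≤ (Y : ℤ) ^ 2 := by
        simp only [P, I, mem_product, mem_Icc] at hv
        simp only [h]
        have ha : a ^ 2 ≤ (Y : ℤ) ^ 2 := sq_le_sq' hv.1.1 hv.1.2
        have hc : c ^ 2 ≤ (Y : ℤ) ^ 2 := sq_le_sq' hv.2.1 hv.2.2
        rw [abs_le]
        constructor <;> nlinarith [sq_nonneg a, sq_nonneg c]
      rw [Nat.cast_natAbs]
      exact_mod_cast this
    have h4 : ((h (a, c)).natAbs : ℝ) ^ (η / 2) ≤ (Y : ℝ) ^ η := by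
      calc _ ≤ ((Y : ℝ) ^ 2) ^ (η / 2) := Real.rpow_le_rpow (by positivity) h3 (by positivity)
        _ = _ := by
          rw [← Real.rpow_natCast, ← Real.rpow_mul (by positivity)]
          congr 1
          push_cast
          ring
    calc (#{u ∈ P | h u = h (a, c)} : ℝ) ≤ 2 * #(h (a, c)).natAbs.divisors := by exact_mod_cast h1
      _ ≤ 2 * (C * ((h (a, c)).natAbs : ℝ) ^ (η / 2)) := by gcongr
      _ ≤ 2 * (C * (Y : ℝ) ^ η) := by gcongr
      _ = _ := by ring
  have hsum : (#{u ∈ P ×ˢ P | h u.1 = h u.2} : ℝ) = ∑ v ∈ P, (#{u ∈ P | h u = h v} : ℝ) := by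
    rw [card_eq_sum_card_fiberwise (f := Prod.snd) (t := P)
      (fun u hu => (mem_product.mp (mem_filter.mp (mem_coe.mp hu)).1).2)]
    push_cast
    refine sum_congr rfl fun v hv => ?_
    congr 1
    refine card_bij (fun u _ => u.1) ?_ ?_ ?_
    · rintro ⟨u, w⟩ hu
      simp only [mem_filter, mem_product] at hu ⊢
      exact ⟨hu.1.1.1, by rw [hu.1.2, hu.2]⟩
    · rintro ⟨u, w⟩ hu ⟨u', w'⟩ hu' e
      simp only [mem_filter] at hu hu' e
      rw [e, hu.2, hu'.2]
    · intro u hu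
      rw [mem_filter] at hu
      exact ⟨(u, v), by simp [hu.1, hv, hu.2], rfl⟩
  change (#{u ∈ P ×ˢ P | h u.1 = h u.2} : ℝ) ≤ _
  rw [hsum, ← sum_filter_add_sum_filter_not P (fun v => h v = 0)]
  have hA : ∑ v ∈ P with h v = 0, (#{u ∈ P | h u = h v} : ℝ) ≤ 36 * (Y : ℝ) ^ 2 * (Y : ℝ) ^ η := by
    calc _ = ∑ v ∈ Z, (#Z : ℝ) := sum_congr rfl fun v hv => by rw [(mem_filter.mp hv).2]
      _ = #Z * #Z := by rw [sum_const, nsmul_eq_mul]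
      _ ≤ (6 * Y) * (6 * Y) := by gcongr
      _ = 36 * (Y : ℝ) ^ 2 * 1 := by ring
      _ ≤ _ := by gcongr
  have hB : ∑ v ∈ P with ¬ h v = 0, (#{u ∈ P | h u = h v} : ℝ) ≤
      18 * C * (Y : ℝ) ^ 2 * (Y : ℝ) ^ η := by
    calc _ ≤ ∑ v ∈ P with ¬ h v = 0, 2 * C * (Y : ℝ) ^ η :=
          sum_le_sum fun v hv => hfib v (mem_filter.mp hv).1 (mem_filter.mp hv).2
      _ ≤ (#P : ℝ) * (2 * C * (Y : ℝ) ^ η) := by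
          rw [sum_const, nsmul_eq_mul]
          gcongr
          exact filter_subset _ _
      _ ≤ (9 * (Y : ℝ) ^ 2) * (2 * C * (Y : ℝ) ^ η) := by
          gcongr
          rw [card_product, hIc]
          push_cast
          nlinarith
      _ = _ := by ring
  linarith

open Finset in
/-- The additive energy modulo `r` of the squares up to `Y ^ 2`, with weights. -/
theorem card_energy_zmod_le {η : ℝ} (hη : 0 < η) (K : ℕ) : ∃ C : ℝ, 0 < C ∧ ∀ Y : ℕ, 1 ≤ Y →
    ∀ r : ℕ, 0 < r → Y ^ 2 ≤ K * r → ∀ μ ν : ZMod r, IsUnit μ → IsUnit ν →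
    (#{u ∈ (Icc (-(Y : ℤ)) Y ×ˢ Icc (-(Y : ℤ)) Y) ×ˢ (Icc (-(Y : ℤ)) Y ×ˢ Icc (-(Y : ℤ)) Y) |
      μ * (u.1.1 : ZMod r) ^ 2 + ν * (u.1.2 : ZMod r) ^ 2 =
        μ * (u.2.1 : ZMod r) ^ 2 + ν * (u.2.2 : ZMod r) ^ 2} : ℝ) ≤
      C * (Y : ℝ) ^ 2 * (Y : ℝ) ^ η := by
  obtain ⟨C, hC, hE⟩ := card_energy_int_le hη
  refine ⟨(8 * K + 1) * C, by positivity, fun Y hY r hr hK μ ν hμ hν => ?_⟩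
  specialize hE Y hY
  set I := Icc (-(Y : ℤ)) Y with hI
  set P := I ×ˢ I
  set h : ℤ × ℤ → ℤ := fun u => u.1 ^ 2 - u.2 ^ 2
  have hP : ∀ u ∈ P, |h u| ≤ (Y : ℤ) ^ 2 := by
    rintro ⟨a, c⟩ hv
    simp only [P, I, mem_product, mem_Icc] at hv
    have ha : a ^ 2 ≤ (Y : ℤ) ^ 2 := sq_le_sq' hv.1.1 hv.1.2
    have hc : c ^ 2 ≤ (Y : ℤ) ^ 2 := sq_le_sq' hv.2.1 hv.2.2
    rw [abs_le]
    constructor <;> simp only [h] <;> nlinarith [sq_nonneg a, sq_nonneg c]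
  set E := #{u ∈ P ×ˢ P | h u.1 = h u.2}
  -- Values of `h` are at most `K * r` in size, so congruent values differ by `j * r` with `j`
  -- bounded; `|j| ≤ 4 * K` is generous. Shifting by `j * r` preserves self-coincidences, so each
  -- `j` contributes at most `E`.
  have hmod : #{u ∈ P ×ˢ P | (h u.1 : ZMod r) = (h u.2 : ZMod r)} ≤ (8 * K + 1) * E := by
    have hsub : {u ∈ P ×ˢ P | (h u.1 : ZMod r) = (h u.2 : ZMod r)} ⊆
        (Icc (-(4 * K : ℤ)) (4 * K)).biUnion fun j => {u ∈ P ×ˢ P | h u.1 = h u.2 + j * r} := by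
      rintro ⟨u, v⟩ huv
      simp only [mem_filter, mem_product] at huv
      simp only [mem_biUnion, mem_filter, mem_product]
      obtain ⟨j, hj⟩ := (ZMod.intCast_eq_intCast_iff_dvd_sub _ _ r).mp huv.2.symm
      refine ⟨j, ?_, huv.1, by linarith⟩
      have h1 := abs_le.mp (hP u huv.1.1)
      have h2 := abs_le.mp (hP v huv.1.2)
      have hK' : (Y : ℤ) ^ 2 ≤ K * r := by exact_mod_cast hK
      have hr' : (0 : ℤ) < r := by exact_mod_cast hr
      rw [mem_Icc]
      constructor
      · by_contra hlt
        push Not at hlt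
        have : (r : ℤ) * j ≤ r * (-(4 * K) - 1) := by gcongr; omega
        nlinarith
      · by_contra hlt
        push Not at hlt
        have : (r : ℤ) * (4 * K + 1) ≤ r * j := by gcongr; omega
        nlinarith
    refine (card_le_card hsub).trans (card_biUnion_le.trans ?_)
    calc _ ≤ ∑ j ∈ Icc (-(4 * K : ℤ)) (4 * K), E := by
          refine sum_le_sum fun j _ => ?_
          have := two_mul_card_coincidences_le P h (fun v => h v + j * r)
          simp only [add_left_inj] at this
          change _ ≤ E + E at this
          omega
      _ = _ := by
          rw [sum_const, Int.card_Icc, smul_eq_mul]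
          congr 1
          omega
  -- Rearranged as `μ * (a² - c²) = ν * (d² - b²)`, this is a coincidence of two functions in whose
  -- self-coincidences the units cancel.
  have hfin : #{u ∈ P ×ˢ P | μ * (u.1.1 : ZMod r) ^ 2 + ν * (u.1.2 : ZMod r) ^ 2 =
        μ * (u.2.1 : ZMod r) ^ 2 + ν * (u.2.2 : ZMod r) ^ 2} ≤
      #{u ∈ P ×ˢ P | (h u.1 : ZMod r) = (h u.2 : ZMod r)} := by
    have h1 := two_mul_card_coincidences_le P (fun u => μ * (h u : ZMod r))
      (fun u => ν * (h u : ZMod r))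
    simp only [hμ.mul_right_inj, hν.mul_right_inj] at h1
    have h2 : #{u ∈ P ×ˢ P | μ * (u.1.1 : ZMod r) ^ 2 + ν * (u.1.2 : ZMod r) ^ 2 =
        μ * (u.2.1 : ZMod r) ^ 2 + ν * (u.2.2 : ZMod r) ^ 2} ≤
        #{u ∈ P ×ˢ P | μ * (h u.1 : ZMod r) = ν * (h u.2 : ZMod r)} := by
      refine card_le_card_of_injOn (fun u => ((u.1.1, u.2.1), (u.2.2, u.1.2))) ?_ ?_
      · rintro ⟨⟨a, b⟩, ⟨c, d⟩⟩ hu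
        simp only [coe_filter, Set.mem_ofPred_eq, P, mem_product] at hu ⊢
        refine ⟨⟨⟨hu.1.1.1, hu.1.2.1⟩, hu.1.2.2, hu.1.1.2⟩, ?_⟩
        simp only [h]
        push_cast
        linear_combination hu.2
      · rintro ⟨⟨a, b⟩, ⟨c, d⟩⟩ _ ⟨⟨a', b'⟩, ⟨c', d'⟩⟩ _ e
        simp only [Prod.mk.injEq] at e ⊢
        tauto
    omega
  calc _ ≤ ((8 * K + 1) * E : ℝ) := by exact_mod_cast hfin.trans hmod
    _ ≤ (8 * K + 1) * (C * (Y : ℝ) ^ 2 * (Y : ℝ) ^ η) := by gcongr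
    _ = _ := by ring

/-! ### Diagonal congruences in small boxes. -/

/-- The integer vectors with all coordinates of absolute value at most `Y`. -/
noncomputable def intBox (n Y : ℕ) : Finset (Fin n → ℤ) :=
  Fintype.piFinset fun _ => Finset.Icc (-(Y : ℤ)) Y

open Finset in
/-- A diagonal quadratic congruence modulo `r` in `k + 4` variables has few solutions in a box of
side at most about `√r`. -/
theorem card_diag_zmod_le {η : ℝ} (hη : 0 < η) (K k : ℕ) : ∃ C : ℝ, 0 < C ∧ ∀ Y : ℕ, 1 ≤ Y →
    ∀ r : ℕ, 0 < r → Y ^ 2 ≤ K * r → ∀ μ : Fin (k + 4) → ZMod r, (∀ i, IsUnit (μ i)) →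
    ∀ c : ZMod r,
    (#{y ∈ intBox (k + 4) Y |
      ∑ i, μ i * (y i : ZMod r) ^ 2 = c} : ℝ) ≤ C * (Y : ℝ) ^ (k + 2) * (Y : ℝ) ^ η := by
  induction k with
  | zero =>
    obtain ⟨C, hC, hE⟩ := card_energy_zmod_le hη K
    refine ⟨C, hC, fun Y hY r hr hK μ hμ c => ?_⟩
    set P := Icc (-(Y : ℤ)) Y ×ˢ Icc (-(Y : ℤ)) Y
    -- Splitting the four variables two and two turns solutions into coincidences of two binary
    -- forms, each controlled by its energy.
    have h1 := two_mul_card_coincidences_le P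
      (fun u => μ 0 * (u.1 : ZMod r) ^ 2 + μ 1 * (u.2 : ZMod r) ^ 2)
      (fun u => c - (μ 2 * (u.1 : ZMod r) ^ 2 + μ 3 * (u.2 : ZMod r) ^ 2))
    simp only [sub_right_inj] at h1
    have h2 : #{y ∈ intBox (0 + 4) Y |
        ∑ i, μ i * (y i : ZMod r) ^ 2 = c} ≤
        #{u ∈ P ×ˢ P | μ 0 * (u.1.1 : ZMod r) ^ 2 + μ 1 * (u.1.2 : ZMod r) ^ 2 =
          c - (μ 2 * (u.2.1 : ZMod r) ^ 2 + μ 3 * (u.2.2 : ZMod r) ^ 2)} := by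
      refine card_le_card_of_injOn (fun y => ((y 0, y 1), (y 2, y 3))) ?_ ?_
      · intro y hy
        simp only [coe_filter, Set.mem_ofPred_eq, intBox, Fintype.mem_piFinset] at hy
        have h3 := (Fin.sum_univ_four (fun i : Fin 4 => μ i * (y i : ZMod r) ^ 2)).symm.trans hy.2
        simp only [coe_filter, Set.mem_ofPred_eq, P, mem_product]
        exact ⟨⟨⟨hy.1 _, hy.1 _⟩, hy.1 _, hy.1 _⟩, by linear_combination h3⟩
      · intro y _ y' _ e
        simp only [Prod.mk.injEq] at e
        funext i
        fin_cases i
        exacts [e.1.1, e.1.2, e.2.1, e.2.2]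
    have e1 := hE Y hY r hr hK (μ 0) (μ 1) (hμ _) (hμ _)
    have e2 := hE Y hY r hr hK (μ 2) (μ 3) (hμ _) (hμ _)
    have h3 := (Nat.mul_le_mul_left 2 h2).trans h1
    have h4 := (Nat.cast_le (α := ℝ)).mpr h3
    push_cast at h4
    norm_num only [zero_add]
    linarith
  | succ k ih =>
    obtain ⟨C, hC, hE⟩ := ih
    refine ⟨3 * C, by positivity, fun Y hY r hr hK μ hμ c => ?_⟩
    set I := Icc (-(Y : ℤ)) Y with hI
    have hIc : #I = 2 * Y + 1 := by rw [hI, Int.card_Icc]; omega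
    have hY1 : (1 : ℝ) ≤ Y := by exact_mod_cast hY
    -- An additional variable is simply fixed, at the cost of `2 * Y + 1 ≤ 3 * Y` choices.
    rw [card_eq_sum_card_fiberwise (f := fun y : Fin (k + 1 + 4) → ℤ => y 0) (t := I)
      (fun y hy => by
        simp only [coe_filter, Set.mem_ofPred_eq, intBox, Fintype.mem_piFinset] at hy
        exact hy.1 0)]
    push_cast
    calc _ ≤ ∑ a ∈ I, C * (Y : ℝ) ^ (k + 2) * (Y : ℝ) ^ η := by
          refine sum_le_sum fun a _ => ?_
          refine le_trans ?_ (hE Y hY r hr hK (fun i => μ i.succ) (fun i => hμ _)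
            (c - μ 0 * (a : ZMod r) ^ 2))
          norm_cast
          refine card_le_card_of_injOn (fun y i => y i.succ) ?_ ?_
          · intro y hy
            simp only [coe_filter, Set.mem_ofPred_eq, mem_filter, intBox, Fintype.mem_piFinset] at hy ⊢
            refine ⟨fun i => hy.1.1 _, ?_⟩
            have := hy.1.2
            rw [Fin.sum_univ_succ, hy.2] at this
            linear_combination this
          · intro y hy y' hy' e
            simp only [coe_filter, Set.mem_ofPred_eq, mem_filter] at hy hy'
            funext i
            refine Fin.cases (hy.2.trans hy'.2.symm) (fun j => congrFun e j) i
      _ = (2 * Y + 1) * (C * (Y : ℝ) ^ (k + 2) * (Y : ℝ) ^ η) := by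
          rw [sum_const, hIc, nsmul_eq_mul]; push_cast; ring
      _ ≤ (3 * Y) * (C * (Y : ℝ) ^ (k + 2) * (Y : ℝ) ^ η) := by
          gcongr; linarith
      _ = _ := by ring

/-! ### Quadratic Gauss sums over a finite ring. -/

theorem addChar_map_sum {A M ι : Type*} [AddCommMonoid A] [CommMonoid M] (ψ : AddChar A M)
    (s : Finset ι) (f : ι → A) : ψ (∑ i ∈ s, f i) = ∏ i ∈ s, ψ (f i) := by
  classical
  induction s using Finset.induction_on with
  | empty => simp
  | insert a s ha ih => rw [Finset.sum_insert ha, Finset.prod_insert ha, ψ.map_add_eq_mul, ih]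

section QuadraticSums

variable {R : Type*} [CommRing R] [Fintype R] {n : ℕ}

/-- The quadratic exponential sum `∑ ψ(a x² + b x)`. -/
noncomputable def quadSum (ψ : AddChar R ℂ) (a b : R) : ℂ := ∑ x, ψ (a * x ^ 2 + b * x)

/-- Weyl differencing: after squaring and substituting `x = y + h`, the sum over `y` is linear with
frequency `2 * a * h`, so only `h = 0` survives. -/
theorem norm_quadSum [DecidableEq R] {ψ : AddChar R ℂ} (hψ : ψ.IsPrimitive) {a : R}
    (ha : IsUnit (2 * a)) (b : R) : ‖quadSum ψ a b‖ = √(Fintype.card R) := by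
  rw [← Real.sqrt_sq (norm_nonneg _)]
  congr 1
  have hr : 0 < ringChar R := by
    have := Finite.of_fintype R
    exact Nat.pos_of_ne_zero (CharP.ringChar_ne_zero_of_finite R)
  have h : ((‖quadSum ψ a b‖ ^ 2 : ℝ) : ℂ) = (Fintype.card R : ℂ) := by
    rw [← Complex.normSq_eq_norm_sq, ← Complex.mul_conj, quadSum, map_sum, Finset.sum_mul_sum]
    calc ∑ x, ∑ y, ψ (a * x ^ 2 + b * x) * (starRingEnd ℂ) (ψ (a * y ^ 2 + b * y))
        = ∑ y, ∑ x, ψ (a * x ^ 2 + b * x) * (starRingEnd ℂ) (ψ (a * y ^ 2 + b * y)) :=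
          Finset.sum_comm
      _ = ∑ y, ∑ h, ψ (a * h ^ 2 + b * h) * ψ (y * (2 * a * h)) := by
          refine Finset.sum_congr rfl fun y _ => ?_
          rw [← Equiv.sum_comp (Equiv.addRight y)]
          refine Finset.sum_congr rfl fun h _ => ?_
          rw [AddChar.starComp_apply hr, AddChar.inv_apply,
            ← AddChar.map_add_eq_mul, ← AddChar.map_add_eq_mul]
          congr 1
          simp only [Equiv.coe_addRight]
          ring
      _ = ∑ h, ψ (a * h ^ 2 + b * h) * ∑ y, ψ (y * (2 * a * h)) := by
          rw [Finset.sum_comm]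
          exact Finset.sum_congr rfl fun h _ => (Finset.mul_sum _ _ _).symm
      _ = ∑ h, ψ (a * h ^ 2 + b * h) * if h = 0 then (Fintype.card R : ℂ) else 0 := by
          refine Finset.sum_congr rfl fun h _ => ?_
          rw [AddChar.sum_mulShift _ hψ]
          simp only [ha.mul_right_eq_zero]
          push_cast
          rfl
      _ = _ := by simp
  exact_mod_cast h

theorem quadSum_mul_sq (ψ : AddChar R ℂ) (a : R) (u : Rˣ) :
    quadSum ψ (a * (u : R) ^ 2) 0 = quadSum ψ a 0 := by
  rw [quadSum, quadSum, ← Equiv.sum_comp (Units.mulLeft u) fun x => ψ (a * x ^ 2 + 0 * x)]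
  refine Finset.sum_congr rfl fun x _ => ?_
  simp only [Units.mulLeft_apply]
  ring_nf

/-- Completing the square by the translation `x ↦ x - 2 * d * b`. -/
theorem quadSum_eq (ψ : AddChar R ℂ) {a b d : R} (h : 4 * a * d = 1) :
    quadSum ψ a b = ψ (-(d * b ^ 2)) * quadSum ψ a 0 := by
  rw [quadSum, quadSum, ← Equiv.sum_comp (Equiv.addRight (-(2 * d * b))), Finset.mul_sum]
  refine Finset.sum_congr rfl fun x _ => ?_
  rw [← AddChar.map_add_eq_mul]
  congr 1
  simp only [Equiv.coe_addRight]
  linear_combination (d * b ^ 2 - b * x) * h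

theorem sum_quadForm_eq_prod_quadSum (ψ : AddChar R ℂ) (a : R) (c y : Fin n → R) :
    ∑ x : Fin n → R, ψ (a * ∑ i, c i * x i ^ 2 + ∑ i, x i * y i) =
      ∏ i, quadSum ψ (a * c i) (y i) := by
  simp only [quadSum]
  rw [Finset.prod_univ_sum, Fintype.piFinset_univ]
  refine Finset.sum_congr rfl fun x _ => ?_
  rw [← addChar_map_sum, Finset.mul_sum, ← Finset.sum_add_distrib]
  congr 1
  exact Finset.sum_congr rfl fun i _ => by ring

open Classical in
/-- The sum over the zeros of a quadratic form as an average of quadratic exponential sums. -/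
theorem card_mul_sum_zeros {ψ : AddChar R ℂ} (hψ : ψ.IsPrimitive) (c y : Fin n → R) :
    (Fintype.card R : ℂ) * ∑ x : Fin n → R with ∑ i, c i * x i ^ 2 = 0, ψ (∑ i, x i * y i) =
      ∑ a, ∏ i, quadSum ψ (a * c i) (y i) := by
  simp_rw [← sum_quadForm_eq_prod_quadSum, AddChar.map_add_eq_mul]
  rw [Finset.sum_comm, Finset.mul_sum, Finset.sum_filter]
  refine Finset.sum_congr rfl fun x _ => ?_
  rw [← Finset.sum_mul, AddChar.sum_mulShift _ hψ]
  split_ifs <;> simp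

open Classical in
/-- The zeros of the quadratic form with coefficients `c` having a unit among their coordinates. -/
noncomputable def primZeros (c : Fin n → R) : Finset (Fin n → R) :=
  {x | ∑ i, c i * x i ^ 2 = 0 ∧ ∃ i, IsUnit (x i)}

/-- The exponential sum over `primZeros c` at the frequency `y`. -/
noncomputable def primSum (ψ : AddChar R ℂ) (c y : Fin n → R) : ℂ :=
  ∑ x ∈ primZeros c, ψ (∑ i, x i * y i)

theorem mem_primZeros {c x : Fin n → R} :
    x ∈ primZeros c ↔ ∑ i, c i * x i ^ 2 = 0 ∧ ∃ i, IsUnit (x i) := by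
  simp [primZeros]

theorem norm_primSum_le (ψ : AddChar R ℂ) (c y : Fin n → R) :
    ‖primSum ψ c y‖ ≤ (Fintype.card R : ℝ) ^ n := by
  refine (norm_sum_le _ _).trans ?_
  have : Finite R := Finite.of_fintype R
  simp only [AddChar.norm_apply, Finset.sum_const, nsmul_eq_mul, mul_one]
  have h := Finset.card_le_univ (primZeros c)
  rw [Fintype.card_fun, Fintype.card_fin] at h
  exact_mod_cast h

end QuadraticSums

/-! ### Exponential sums over primitive zeros modulo prime powers. -/

theorem prime_pow_eq_zero {p k j : ℕ} (h : k ≤ j) : (p : ZMod (p ^ k)) ^ j = 0 := by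
  obtain ⟨i, rfl⟩ := Nat.exists_eq_add_of_le h
  rw [pow_add, ← Nat.cast_pow, ZMod.natCast_self, zero_mul]

section PrimePower

variable {p k n : ℕ} [Fact p.Prime]

instance primePow_neZero : NeZero (p ^ k) := ⟨pow_ne_zero _ (Fact.out : p.Prime).ne_zero⟩

theorem exists_eq_mul_of_not_isUnit {a : ZMod (p ^ k)} (ha : ¬ IsUnit a) :
    ∃ b, a = (p : ZMod (p ^ k)) * b := by
  have hp : p.Prime := Fact.out
  rw [← ZMod.natCast_zmod_val a, ZMod.isUnit_iff_coprime] at ha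
  have h : p ∣ a.val := by
    by_contra h
    exact ha (((Nat.Prime.coprime_iff_not_dvd hp).mpr h).symm.pow_right k)
  obtain ⟨b, hb⟩ := h
  exact ⟨b, by rw [← Nat.cast_mul, ← hb, ZMod.natCast_zmod_val]⟩

theorem not_isUnit_prime_mul (hk : k ≠ 0) (b : ZMod (p ^ k)) :
    ¬ IsUnit ((p : ZMod (p ^ k)) * b) := by
  intro h
  have h1 := isUnit_of_mul_isUnit_left h
  rw [ZMod.isUnit_iff_coprime] at h1
  have hp : p.Prime := Fact.out
  exact hp.one_lt.ne' ((Nat.coprime_self p).mp ((Nat.coprime_pow_right_iff (Nat.pos_of_ne_zero hk) _ _).mp h1))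

theorem isUnit_add_prime_mul_iff (hk : k ≠ 0) (a b : ZMod (p ^ k)) :
    IsUnit (a + (p : ZMod (p ^ k)) * b) ↔ IsUnit a := by
  rw [← not_iff_not]
  constructor
  · intro h
    obtain ⟨d, hd⟩ := exists_eq_mul_of_not_isUnit h
    rw [show a = (p : ZMod (p ^ k)) * (d - b) by linear_combination hd]
    exact not_isUnit_prime_mul hk _
  · intro h
    obtain ⟨d, rfl⟩ := exists_eq_mul_of_not_isUnit h
    rw [← mul_add]
    exact not_isUnit_prime_mul hk _

/-- A residue that is `1` modulo an odd prime `p` is a square modulo `p ^ k`. -/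
theorem exists_unit_sq_eq_one_add_prime_mul (hp2 : Odd p) (s : ZMod (p ^ k)) :
    ∃ u : (ZMod (p ^ k))ˣ, (u : ZMod (p ^ k)) ^ 2 = 1 + p * s := by
  set w : ZMod (p ^ k) := 1 + p * s
  have h1 : w ^ p ^ k = 1 := by
    have h := dvd_sub_pow_of_dvd_sub (p := p) (a := w) (b := 1) ⟨s, by simp [w]⟩ k
    rw [prime_pow_eq_zero (Nat.le_succ k), zero_dvd_iff, one_pow, sub_eq_zero] at h
    exact h
  -- The order of `w` divides the odd number `2 * j + 1`, hence `w = (w ^ (j + 1)) ^ 2`.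
  obtain ⟨j, hj⟩ : Odd (p ^ k) := hp2.pow
  have hu : IsUnit w := IsUnit.of_mul_eq_one (w ^ (2 * j)) (by rw [← pow_succ', ← hj, h1])
  refine ⟨hu.unit ^ (j + 1), ?_⟩
  rw [Units.val_pow_eq_pow_val, IsUnit.unit_spec, ← pow_mul,
    show (j + 1) * 2 = (2 * j + 1) + 1 by ring, pow_succ, ← hj, h1, one_mul]

theorem exists_addChar_mul_ne_one {r : ℕ} [NeZero r] {b : ZMod r} (hb : b ≠ 0) :
    ∃ z, ZMod.stdAddChar (b * z) ≠ 1 := by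
  have h := ZMod.isPrimitive_stdAddChar r hb
  rw [AddChar.ne_one_iff] at h
  simpa only [AddChar.mulShift_apply] using h

theorem pow_pred_ne_zero (hk : k ≠ 0) : (p : ZMod (p ^ k)) ^ (k - 1) ≠ 0 := by
  rw [← Nat.cast_pow, Ne, ZMod.natCast_eq_zero_iff, Nat.pow_dvd_pow_iff_le_right
    (Fact.out : p.Prime).one_lt]
  omega

/-- Translation by `p ^ (k - 1) * z` does not change the quadratic term, since `p` divides `a`, and
multiplies the sum by a value of the character that can be chosen different from `1`. -/
theorem quadSum_eq_zero_of_not_isUnit (hk : k ≠ 0) {a b : ZMod (p ^ k)} (ha : ¬ IsUnit a)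
    (hb : IsUnit b) : quadSum ZMod.stdAddChar a b = 0 := by
  obtain ⟨d, rfl⟩ := exists_eq_mul_of_not_isUnit ha
  obtain ⟨z, hz⟩ := exists_addChar_mul_ne_one (b := b * (p : ZMod (p ^ k)) ^ (k - 1))
    (by rw [Ne, hb.mul_right_eq_zero]; exact pow_pred_ne_zero hk)
  have h0 : (p : ZMod (p ^ k)) * p ^ (k - 1) = 0 := by
    rw [← pow_succ']; exact prime_pow_eq_zero (by omega)
  have h : quadSum ZMod.stdAddChar ((p : ZMod (p ^ k)) * d) b =
      ZMod.stdAddChar (b * (p : ZMod (p ^ k)) ^ (k - 1) * z) *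
        quadSum ZMod.stdAddChar ((p : ZMod (p ^ k)) * d) b := by
    conv_lhs => rw [quadSum, ← Equiv.sum_comp (Equiv.addRight ((p : ZMod (p ^ k)) ^ (k - 1) * z))]
    rw [quadSum, Finset.mul_sum]
    refine Finset.sum_congr rfl fun x _ => ?_
    rw [← AddChar.map_add_eq_mul]
    congr 1
    simp only [Equiv.coe_addRight]
    linear_combination (d * z * (2 * x + p ^ (k - 1) * z)) * h0
  by_contra hne
  exact hz (mul_right_cancel₀ hne (h.symm.trans (one_mul _).symm))

open Classical in
/-- The contribution of the zeros without unit coordinates vanishes at primitive frequencies. -/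
theorem sum_nonprimitive_zeros_eq_zero (hk : 2 ≤ k) (c y : Fin n → ZMod (p ^ k)) {i : Fin n}
    (hy : IsUnit (y i)) :
    ∑ x : Fin n → ZMod (p ^ k) with ∑ i, c i * x i ^ 2 = 0 ∧ ¬ ∃ i, IsUnit (x i),
      ZMod.stdAddChar (∑ i, x i * y i) = 0 := by
  obtain ⟨z, hz⟩ := exists_addChar_mul_ne_one (b := y i * (p : ZMod (p ^ k)) ^ (k - 1))
    (by rw [Ne, hy.mul_right_eq_zero]; exact pow_pred_ne_zero (by omega))
  obtain ⟨j, rfl⟩ := Nat.exists_eq_add_of_le' hk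
  set P : ZMod (p ^ (j + 2)) := (p : ZMod (p ^ (j + 2))) ^ (j + 2 - 1)
  have hP : P = p * p ^ j := by simp only [P]; rw [← pow_succ']; congr 1
  have h0 : (p : ZMod (p ^ (j + 2))) * P = 0 := by
    rw [hP, ← mul_assoc, ← sq, ← pow_add]; exact prime_pow_eq_zero (by omega)
  set S := ∑ x : Fin n → ZMod (p ^ (j + 2)) with ∑ i, c i * x i ^ 2 = 0 ∧ ¬ ∃ i, IsUnit (x i),
      ZMod.stdAddChar (∑ i, x i * y i) with hS
  -- Translate `x i` by `P * z`. As `p` divides `x i` and `P * P = 0` (this needs `k ≥ 2`), neither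
  -- the form nor non-primitivity changes.
  have h : S = ZMod.stdAddChar (y i * P * z) * S := by
    conv_lhs => rw [hS, Finset.sum_filter,
      ← Equiv.sum_comp (Equiv.addRight (Pi.single i (P * z) : Fin n → ZMod (p ^ (j + 2))))]
    rw [hS, Finset.sum_filter, Finset.mul_sum]
    refine Finset.sum_congr rfl fun x _ => ?_
    rw [Equiv.coe_addRight]
    have hu : (∃ l, IsUnit (x l + (Pi.single i (P * z) : Fin n → ZMod (p ^ (j + 2))) l)) ↔
        ∃ l, IsUnit (x l) := by
      refine exists_congr fun l => ?_
      by_cases hl : l = i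
      · subst hl
        rw [Pi.single_eq_same, hP, mul_assoc]
        exact isUnit_add_prime_mul_iff (by omega) _ _
      · rw [Pi.single_eq_of_ne hl, add_zero]
    by_cases hx : ∃ l, IsUnit (x l)
    · rw [if_neg (fun h => h.2 (hu.mpr hx)), if_neg (fun h => h.2 hx), mul_zero]
    have hQ : ∑ l, c l * (x l + (Pi.single i (P * z) : Fin n → ZMod (p ^ (j + 2))) l) ^ 2 =
        ∑ l, c l * x l ^ 2 := by
      refine Finset.sum_congr rfl fun l _ => ?_
      by_cases hl : l = i
      · subst hl
        obtain ⟨d, hd⟩ := exists_eq_mul_of_not_isUnit (not_exists.mp hx l)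
        rw [Pi.single_eq_same, hd]
        have h1 : P * P = 0 := by
          nth_rewrite 1 [hP]
          linear_combination (p : ZMod (p ^ (j + 2))) ^ j * h0
        linear_combination (2 * c l * d * z) * h0 + c l * z ^ 2 * h1
      · rw [Pi.single_eq_of_ne hl, add_zero]
    by_cases hx0 : ∑ l, c l * x l ^ 2 = 0
    · rw [if_pos ⟨hQ.trans hx0, fun h => hx (hu.mp h)⟩, if_pos ⟨hx0, hx⟩,
        ← AddChar.map_add_eq_mul]
      congr 1
      simp only [Pi.add_apply, add_mul, Finset.sum_add_distrib]
      rw [Finset.sum_eq_single (f := fun l => (Pi.single i (P * z) : Fin n → ZMod _) l * y l) i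
        (fun l _ hl => by rw [Pi.single_eq_of_ne hl, zero_mul]) (by simp), Pi.single_eq_same]
      ring
    · rw [if_neg (fun h => hx0 (hQ.symm.trans h.1)), if_neg (fun h => hx0 h.1), mul_zero]
  by_contra hne
  exact hz (mul_right_cancel₀ hne (h.symm.trans (one_mul _).symm))

/-- For `k ≥ 2` and primitive frequencies, the exponential sum over the primitive zeros has
square-root size, and vanishes unless `p ^ (k - 1)` divides the dual form. -/
theorem norm_primSum_le_of_two_le (hp2 : Odd p) (hk : 2 ≤ k) {c d y : Fin n → ZMod (p ^ k)}
    (hcd : ∀ i, 4 * c i * d i = 1) (hy : ∃ i, IsUnit (y i)) :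
    ‖primSum ZMod.stdAddChar c y‖ ≤ √((p : ℝ) ^ k) ^ n ∧
      ((p : ZMod (p ^ k)) * ∑ i, d i * y i ^ 2 ≠ 0 → primSum ZMod.stdAddChar c y = 0) := by
  classical
  obtain ⟨i₀, hi₀⟩ := hy
  set ψ : AddChar (ZMod (p ^ k)) ℂ := ZMod.stdAddChar with hψdef
  have hψ : ψ.IsPrimitive := ZMod.isPrimitive_stdAddChar _
  set q : ℂ := (Fintype.card (ZMod (p ^ k)) : ℂ) with hq
  have hq0 : q ≠ 0 := by
    rw [hq, ZMod.card]; exact Nat.cast_ne_zero.mpr (NeZero.ne _)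
  have h2 : ∀ i, IsUnit (2 * c i) := fun i =>
    IsUnit.of_mul_eq_one (2 * d i) (by linear_combination hcd i)
  have hall : primSum ψ c y =
      ∑ x : Fin n → ZMod (p ^ k) with ∑ i, c i * x i ^ 2 = 0, ψ (∑ i, x i * y i) := by
    rw [← Finset.sum_filter_add_sum_filter_not _ (fun x => ∃ i, IsUnit (x i)),
      Finset.filter_filter, Finset.filter_filter, sum_nonprimitive_zeros_eq_zero hk c y hi₀,
      add_zero]
    exact Finset.sum_congr (by ext; simp [mem_primZeros]) fun _ _ => rfl
  -- Non-unit multipliers drop out: their factor at `i₀` vanishes because `y i₀` is a unit.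
  have hS : q * primSum ψ c y = ∑ t : (ZMod (p ^ k))ˣ, ∏ i, quadSum ψ (t * c i) (y i) := by
    rw [hall]
    have h := card_mul_sum_zeros hψ c y
    refine Eq.trans ?_ (h.trans ?_)
    · congr!
    symm
    refine Finset.sum_of_injOn (fun t : (ZMod (p ^ k))ˣ => (t : ZMod (p ^ k)))
      Units.val_injective.injOn (by simp) ?_ (fun _ _ => rfl)
    intro a _ ha
    refine Finset.prod_eq_zero (Finset.mem_univ i₀) (quadSum_eq_zero_of_not_isUnit (by omega) ?_ hi₀)
    intro hu
    exact ha ⟨(isUnit_of_mul_isUnit_left hu).unit, by simp⟩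
  constructor
  · have h1 : ‖q * primSum ψ c y‖ ≤ (p : ℝ) ^ k * √((p : ℝ) ^ k) ^ n := by
      rw [hS]
      refine (norm_sum_le _ _).trans ?_
      calc _ ≤ ∑ t : (ZMod (p ^ k))ˣ, √((p : ℝ) ^ k) ^ n := by
            refine Finset.sum_le_sum fun t _ => ?_
            rw [norm_prod]
            refine le_of_eq ?_
            rw [Finset.prod_congr rfl (g := fun _ => √((p : ℝ) ^ k)), Finset.prod_const,
              Finset.card_univ, Fintype.card_fin]
            intro i _
            rw [norm_quadSum hψ, ZMod.card]
            · push_cast; rfl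
            · rw [show 2 * ((t : ZMod (p ^ k)) * c i) = t * (2 * c i) by ring]
              exact t.isUnit.mul (h2 i)
        _ ≤ _ := by
            rw [Finset.sum_const, nsmul_eq_mul]
            gcongr
            have := Fintype.card_le_of_injective _ (Units.val_injective (α := ZMod (p ^ k)))
            rw [ZMod.card] at this
            rw [Finset.card_univ]
            exact_mod_cast this
    rw [norm_mul, hq, ZMod.card] at h1
    have hpk : 0 < (p : ℝ) ^ k := by
      have := (Fact.out : p.Prime).pos
      positivity
    rw [Complex.norm_natCast, Nat.cast_pow] at h1
    exact le_of_mul_le_mul_left h1 hpk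
  · intro hρ
    set ρ := ∑ i, d i * y i ^ 2
    set F : (ZMod (p ^ k))ˣ → ℂ := fun t => ∏ i, quadSum ψ (((t⁻¹ : (ZMod (p ^ k))ˣ) : ZMod (p ^ k)) * c i) 0
    -- Replacing `t` by its inverse before completing the squares makes the phase linear in `t`.
    have hS' : q * primSum ψ c y = ∑ t : (ZMod (p ^ k))ˣ, ψ (-(t * ρ)) * F t := by
      rw [hS, ← Equiv.sum_comp (Equiv.inv (ZMod (p ^ k))ˣ)]
      refine Finset.sum_congr rfl fun t _ => ?_
      have : ∀ i, 4 * (((t⁻¹ : (ZMod (p ^ k))ˣ) : ZMod (p ^ k)) * c i) * (t * d i) = 1 := fun i => by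
        linear_combination t.inv_mul * (4 * c i * d i) + hcd i
      simp only [Equiv.inv_apply]
      rw [Finset.prod_congr rfl fun i _ => quadSum_eq ψ (b := y i) (this i),
        Finset.prod_mul_distrib, ← addChar_map_sum]
      congr 2
      rw [Finset.mul_sum, ← Finset.sum_neg_distrib]
      exact Finset.sum_congr rfl fun i _ => by ring
    -- `F` is invariant under multiplication of `t` by squares, and `1 + p * s` is one, so only the
    -- phase changes. Summing over `s` then kills every term unless `p * ρ = 0`.
    have hshift : ∀ s, q * primSum ψ c y =
        ∑ t : (ZMod (p ^ k))ˣ, ψ (-(t * ρ)) * F t * ψ (s * (-(p * ρ * t))) := by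
      intro s
      obtain ⟨u, hu⟩ := exists_unit_sq_eq_one_add_prime_mul hp2 s
      rw [hS', ← Equiv.sum_comp (Equiv.mulRight (u ^ 2))]
      refine Finset.sum_congr rfl fun t _ => ?_
      have hF : F (t * u ^ 2) = F t := by
        refine Finset.prod_congr rfl fun i _ => ?_
        rw [← quadSum_mul_sq ψ (((t⁻¹ : (ZMod (p ^ k))ˣ) : ZMod (p ^ k)) * c i) u⁻¹]
        congr 1
        simp only [mul_inv, Units.val_mul, Units.val_pow_eq_pow_val, ← inv_pow]
        ring
      simp only [Equiv.coe_mulRight]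
      rw [hF, mul_right_comm, ← AddChar.map_add_eq_mul, Units.val_mul, Units.val_pow_eq_pow_val, hu]
      congr 2
      ring
    have h0 : q * (q * primSum ψ c y) = 0 := by
      calc q * (q * primSum ψ c y) = ∑ s : ZMod (p ^ k), q * primSum ψ c y := by
            rw [Finset.sum_const, nsmul_eq_mul, Finset.card_univ]
        _ = ∑ t : (ZMod (p ^ k))ˣ, ∑ s, ψ (-(t * ρ)) * F t * ψ (s * (-(p * ρ * t))) := by
            rw [Finset.sum_comm]
            exact Finset.sum_congr rfl fun s _ => hshift s
        _ = 0 := by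
            refine Finset.sum_eq_zero fun t _ => ?_
            rw [← Finset.mul_sum, AddChar.sum_mulShift _ hψ, if_neg]
            · simp
            · rw [neg_eq_zero, t.isUnit.mul_left_eq_zero]
              exact hρ
    simpa [hq0] using h0

/-- A bound for the exponential sum over the primitive zeros that also covers `k = 1`. -/
theorem norm_primSum_le_of_primitive (hp2 : Odd p) (hk : 1 ≤ k) {c d y : Fin n → ZMod (p ^ k)}
    (hcd : ∀ i, 4 * c i * d i = 1) (hy : ∃ i, IsUnit (y i)) :
    ‖primSum ZMod.stdAddChar c y‖ ≤ (p : ℝ) ^ n * √((p : ℝ) ^ k) ^ n ∧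
      ((p : ZMod (p ^ k)) * ∑ i, d i * y i ^ 2 ≠ 0 → primSum ZMod.stdAddChar c y = 0) := by
  have hp1 : (1 : ℝ) ≤ p := by exact_mod_cast (Fact.out : p.Prime).one_le
  rcases hk.eq_or_lt with rfl | hk
  -- For `k = 1` the trivial bound is enough, and `p = 0` makes the vanishing statement vacuous.
  · constructor
    · refine (norm_primSum_le _ _ _).trans ?_
      rw [ZMod.card, Nat.cast_pow, pow_one]
      exact le_mul_of_one_le_right (by positivity) (one_le_pow₀ (Real.one_le_sqrt.mpr hp1))
    · intro h
      refine absurd ?_ h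
      have := prime_pow_eq_zero (p := p) (le_refl 1)
      rw [(pow_one _).symm.trans this, zero_mul]
  · obtain ⟨h1, h2⟩ := norm_primSum_le_of_two_le hp2 hk hcd hy
    exact ⟨h1.trans (le_mul_of_one_le_left (by positivity) (one_le_pow₀ hp1)), h2⟩

end PrimePower

/-! ### Hensel lifting and reduction of imprimitive frequencies. -/

theorem card_fiber_mul_card {G H : Type*} [AddGroup G] [AddGroup H] [Fintype G] [Fintype H]
    [DecidableEq H] (L : G →+ H) (hL : Function.Surjective L) (h : H) :
    (Finset.univ.filter fun g => L g = h).card * Fintype.card H = Fintype.card G := by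
  have h1 := Finset.card_eq_sum_card_fiberwise (f := L) (s := Finset.univ) (t := Finset.univ)
    (fun _ _ => by simp)
  rw [Finset.card_univ] at h1
  rw [h1, Finset.sum_congr rfl fun x _ => AddMonoidHom.card_fiber_eq_of_mem_range L
    (hL x : x ∈ Set.range L) (hL h : h ∈ Set.range L), Finset.sum_const, Finset.card_univ,
    smul_eq_mul, mul_comm]

/-- The reduction map from residues modulo `p ^ (k + 1)` to residues modulo `p ^ k`. -/
noncomputable def reduceHom (p k : ℕ) : ZMod (p ^ (k + 1)) →+* ZMod (p ^ k) :=
  ZMod.castHom (pow_dvd_pow p (Nat.le_succ k)) _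

theorem reduceHom_surjective {p k : ℕ} : Function.Surjective (reduceHom p k) :=
  ZMod.ringHom_surjective _

section Lifting

variable {p k n : ℕ} [Fact p.Prime]

theorem isUnit_reduceHom_iff (hk : k ≠ 0) (x : ZMod (p ^ (k + 1))) :
    IsUnit (reduceHom p k x) ↔ IsUnit x := by
  have hx : x = (x.val : ZMod (p ^ (k + 1))) := (ZMod.natCast_zmod_val x).symm
  rw [hx, map_natCast, ZMod.isUnit_iff_coprime, ZMod.isUnit_iff_coprime,
    Nat.coprime_pow_right_iff (Nat.pos_of_ne_zero hk), Nat.coprime_pow_right_iff (Nat.succ_pos k)]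

theorem exists_eq_mul_of_reduceHom_eq_zero {x : ZMod (p ^ (k + 1))} (h : reduceHom p k x = 0) :
    ∃ b, x = (p : ZMod (p ^ (k + 1))) ^ k * b := by
  have hx : x = (x.val : ZMod (p ^ (k + 1))) := (ZMod.natCast_zmod_val x).symm
  rw [hx, map_natCast, ZMod.natCast_eq_zero_iff] at h
  obtain ⟨b, hb⟩ := h
  exact ⟨b, by rw [hx, hb]; push_cast; rfl⟩

theorem card_ker_reduceHom :
    Nat.card {u : ZMod (p ^ (k + 1)) // reduceHom p k u = 0} = p := by
  have h := card_fiber_mul_card (reduceHom p k).toAddMonoidHom reduceHom_surjective 0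
  rw [ZMod.card, ZMod.card] at h
  rw [Nat.card_eq_fintype_card, Fintype.card_subtype]
  exact Nat.eq_of_mul_eq_mul_right (pow_pos (Fact.out : p.Prime).pos k) (h.trans (pow_succ' p k))

/-- Products of two elements of the kernel of reduction vanish, so `X + u` is a zero exactly when
`u` solves a linear equation over the kernel. The linear map is onto because `2 * c i₀ * X i₀` is a
unit, so its fibres have `p ^ n / p` elements. -/
theorem card_lifts (hk : k ≠ 0) {c : Fin n → ZMod (p ^ (k + 1))} (hc : ∀ i, IsUnit (2 * c i))
    {x : Fin n → ZMod (p ^ k)} (hx : x ∈ primZeros fun i => reduceHom p k (c i)) :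
    ((primZeros c).filter fun X => (fun i => reduceHom p k (X i)) = x).card = p ^ (n - 1) := by
  classical
  set φ := reduceHom p k
  rw [mem_primZeros] at hx
  obtain ⟨hQ, i₀, hi₀⟩ := hx
  choose X hX using fun i => reduceHom_surjective (x i)
  have hXu : IsUnit (X i₀) := (isUnit_reduceHom_iff hk _).mp (by rw [hX]; exact hi₀)
  set K : AddSubgroup (ZMod (p ^ (k + 1))) := φ.toAddMonoidHom.ker
  have hmul : ∀ u v : K, (u : ZMod (p ^ (k + 1))) * v = 0 := by
    rintro ⟨u, hu⟩ ⟨v, hv⟩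
    obtain ⟨a, rfl⟩ := exists_eq_mul_of_reduceHom_eq_zero hu
    obtain ⟨b, rfl⟩ := exists_eq_mul_of_reduceHom_eq_zero hv
    have := prime_pow_eq_zero (p := p) (show k + 1 ≤ k + k by omega)
    calc (p : ZMod (p ^ (k + 1))) ^ k * a * (p ^ k * b) = p ^ (k + k) * (a * b) := by ring
      _ = 0 := by rw [this, zero_mul]
  have hKmul : ∀ (a : ZMod (p ^ (k + 1))) (u : K), a * u ∈ K := by
    rintro a ⟨u, hu⟩
    change φ (a * u) = 0
    rw [map_mul, show φ u = 0 from hu, mul_zero]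
  let L : (Fin n → K) →+ K := AddMonoidHom.mk'
    (fun u => ⟨∑ i, 2 * c i * X i * u i, AddSubgroup.sum_mem _ fun i _ => hKmul _ _⟩) (by
      intro u v
      ext
      simp only [Pi.add_apply, AddSubgroup.coe_add, mul_add, Finset.sum_add_distrib])
  have hL : Function.Surjective L := by
    intro v
    obtain ⟨w, hw⟩ := ((hc i₀).mul hXu).exists_right_inv
    refine ⟨Pi.single i₀ ⟨w * v, hKmul _ _⟩, ?_⟩
    ext
    change ∑ i, 2 * c i * X i * ((Pi.single i₀ ⟨w * v, hKmul _ _⟩ : Fin n → K) i : ZMod (p ^ (k + 1))) = v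
    rw [Finset.sum_eq_single i₀ (fun i _ hi => by rw [Pi.single_eq_of_ne hi]; simp) (by simp),
      Pi.single_eq_same]
    linear_combination (v : ZMod (p ^ (k + 1))) * hw
  have hQX : -∑ i, c i * X i ^ 2 ∈ K := by
    refine neg_mem ?_
    change φ _ = 0
    rw [map_sum, ← hQ]
    refine Finset.sum_congr rfl fun i _ => ?_
    rw [map_mul, map_pow, hX]
  have hcard := card_fiber_mul_card L hL ⟨_, hQX⟩
  have hK : Fintype.card K = p := by
    rw [← Nat.card_eq_fintype_card]
    exact card_ker_reduceHom (p := p) (k := k)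
  rw [Fintype.card_fun, Fintype.card_fin, hK] at hcard
  have hn : n = (n - 1) + 1 := by have := i₀.pos; omega
  have hbij : ((primZeros c).filter fun X => (fun i => φ (X i)) = x).card =
      (Finset.univ.filter fun g => L g = ⟨_, hQX⟩).card := by
    symm
    refine Finset.card_bij (fun u _ i => X i + u i) ?_ ?_ ?_
    · intro u hu
      rw [Finset.mem_filter, mem_primZeros]
      have hφ : ∀ i, φ (X i + u i) = x i := fun i => by
        rw [map_add, hX, show φ (u i) = 0 from (u i).2, add_zero]
      refine ⟨⟨?_, i₀, ?_⟩, funext hφ⟩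
      · have h1 : ∑ i, 2 * c i * X i * u i = -∑ i, c i * X i ^ 2 :=
          congrArg Subtype.val (Finset.mem_filter.mp hu).2
        calc ∑ i, c i * (X i + u i) ^ 2
            = ∑ i, (c i * X i ^ 2 + 2 * c i * X i * u i) :=
              Finset.sum_congr rfl fun i _ => by linear_combination c i * hmul (u i) (u i)
          _ = 0 := by rw [Finset.sum_add_distrib, h1, add_neg_cancel]
      · rw [← isUnit_reduceHom_iff hk]
        exact (hφ i₀).symm ▸ hi₀
    · intro u _ v _ h
      funext i
      exact Subtype.ext (add_left_cancel (congrFun h i))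
    · intro Z hZ
      rw [Finset.mem_filter, mem_primZeros] at hZ
      have hm : ∀ i, Z i - X i ∈ K := fun i => by
        change φ _ = 0
        rw [map_sub, hX, sub_eq_zero]
        exact congrFun hZ.2 i
      refine ⟨fun i => ⟨_, hm i⟩, ?_, by funext i; simp⟩
      rw [Finset.mem_filter]
      refine ⟨Finset.mem_univ _, Subtype.ext ?_⟩
      change ∑ i, 2 * c i * X i * (Z i - X i) = -∑ i, c i * X i ^ 2
      rw [eq_neg_iff_add_eq_zero, ← Finset.sum_add_distrib, ← hZ.1.1]
      refine Finset.sum_congr rfl fun i _ => ?_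
      linear_combination -c i * hmul ⟨_, hm i⟩ ⟨_, hm i⟩
  rw [hbij]
  refine Nat.eq_of_mul_eq_mul_right (Fact.out : p.Prime).pos ?_
  rw [hcard, ← pow_succ, ← hn]

theorem sum_primZeros_reduceHom (hk : k ≠ 0) {c : Fin n → ZMod (p ^ (k + 1))}
    (hc : ∀ i, IsUnit (2 * c i)) (f : (Fin n → ZMod (p ^ k)) → ℂ) :
    ∑ X ∈ primZeros c, f (fun i => reduceHom p k (X i)) =
      (p : ℂ) ^ (n - 1) * ∑ x ∈ primZeros fun i => reduceHom p k (c i), f x := by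
  classical
  rw [← Finset.sum_fiberwise_of_maps_to (t := primZeros fun i => reduceHom p k (c i))
    (g := fun X i => reduceHom p k (X i)), Finset.mul_sum]
  · refine Finset.sum_congr rfl fun x hx => ?_
    rw [Finset.sum_congr rfl (g := fun _ => f x)
      fun X hX => by rw [(Finset.mem_filter.mp hX).2], Finset.sum_const, nsmul_eq_mul,
      card_lifts hk hc hx]
    push_cast
    rfl
  · intro X hX
    rw [mem_primZeros] at hX ⊢
    obtain ⟨hQ, i, hi⟩ := hX
    refine ⟨?_, i, (isUnit_reduceHom_iff hk _).mpr hi⟩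
    rw [← map_zero (reduceHom p k), ← hQ, map_sum]
    exact Finset.sum_congr rfl fun i _ => by rw [map_mul, map_pow]

theorem stdAddChar_prime_mul (u : ZMod (p ^ (k + 1))) :
    ZMod.stdAddChar ((p : ZMod (p ^ (k + 1))) * u) = ZMod.stdAddChar (reduceHom p k u) := by
  have hu : u = ((u.val : ℤ) : ZMod (p ^ (k + 1))) := by
    rw [Int.cast_natCast, ZMod.natCast_zmod_val]
  have hp : (p : ℂ) ≠ 0 := Nat.cast_ne_zero.mpr (Fact.out : p.Prime).ne_zero
  rw [hu, map_intCast, ZMod.stdAddChar_coe,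
    show (p : ZMod (p ^ (k + 1))) * ((u.val : ℤ) : ZMod (p ^ (k + 1))) =
      (((p : ℤ) * u.val : ℤ) : ZMod (p ^ (k + 1))) by push_cast; rfl, ZMod.stdAddChar_coe]
  congr 1
  push_cast
  field_simp
  ring

/-- The sum of `exp (2πi x·y / p ^ k)` over the primitive zeros `x` modulo `p ^ k` of the diagonal
form with integer coefficients `c`. -/
noncomputable def diagSum (p k : ℕ) [NeZero (p ^ k)] (c y : Fin n → ℤ) : ℂ :=
  primSum (ZMod.stdAddChar (N := p ^ k)) (fun i => (c i : ZMod (p ^ k))) (fun i => (y i : ZMod (p ^ k)))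

theorem isUnit_intCast_of_not_dvd {a : ℤ} (h : ¬ (p : ℤ) ∣ a) : IsUnit (a : ZMod (p ^ k)) := by
  rw [ZMod.coe_int_isUnit_iff_isCoprime, Nat.cast_pow]
  exact ((Nat.prime_iff_prime_int.mp (Fact.out : p.Prime)).coprime_iff_not_dvd.mpr h).pow_left

theorem isUnit_two_mul_intCast (hp2 : Odd p) {a : ℤ} (h : ¬ (p : ℤ) ∣ a) :
    IsUnit (2 * (a : ZMod (p ^ k))) := by
  have h2 : ¬ (p : ℤ) ∣ 2 := by
    intro h
    have := (Nat.prime_dvd_prime_iff_eq Fact.out Nat.prime_two).mp (by exact_mod_cast h)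
    subst this
    exact absurd hp2 (by decide)
  exact (by simpa using isUnit_intCast_of_not_dvd (k := k) h2 : IsUnit (2 : ZMod (p ^ k))).mul
    (isUnit_intCast_of_not_dvd h)

/-- At a frequency divisible by `p` the summand depends only on `x` modulo `p ^ k`, and every
primitive zero there has `p ^ (n - 1)` lifts. -/
theorem diagSum_prime_mul (hp2 : Odd p) (hk : k ≠ 0) {c : Fin n → ℤ} (hc : ∀ i, ¬ (p : ℤ) ∣ c i)
    (y : Fin n → ℤ) :
    diagSum p (k + 1) c (fun i => p * y i) = (p : ℂ) ^ (n - 1) * diagSum p k c y := by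
  have h := sum_primZeros_reduceHom hk (fun i => isUnit_two_mul_intCast (k := k + 1) hp2 (hc i))
    (fun x => ZMod.stdAddChar (∑ i, x i * (y i : ZMod (p ^ k))))
  simp only [map_intCast] at h
  rw [diagSum, diagSum, primSum, primSum, ← h]
  refine Finset.sum_congr rfl fun x _ => ?_
  have e1 : ∑ i, x i * (((p : ℤ) * y i : ℤ) : ZMod (p ^ (k + 1))) =
      (p : ZMod (p ^ (k + 1))) * ∑ i, x i * (y i : ZMod (p ^ (k + 1))) := by
    rw [Finset.mul_sum]
    refine Finset.sum_congr rfl fun i _ => ?_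
    push_cast
    ring
  rw [e1, stdAddChar_prime_mul, map_sum]
  simp only [map_mul, map_intCast]

theorem diagSum_prime_pow_mul (hp2 : Odd p) (hk : k ≠ 0) {c : Fin n → ℤ}
    (hc : ∀ i, ¬ (p : ℤ) ∣ c i) (y : Fin n → ℤ) (ν : ℕ) :
    diagSum p (k + ν) c (fun i => p ^ ν * y i) = ((p : ℂ) ^ (n - 1)) ^ ν * diagSum p k c y := by
  induction ν with
  | zero => simp
  | succ ν ih =>
    have := diagSum_prime_mul (k := k + ν) hp2 (by omega) hc (fun i => p ^ ν * y i)
    rw [ih] at this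
    rw [pow_succ' ((p : ℂ) ^ (n - 1)) ν, mul_assoc, ← this]
    congr 1
    funext i
    ring

theorem diagSum_zero (hp2 : Odd p) (k : ℕ) {c : Fin n → ℤ} (hc : ∀ i, ¬ (p : ℤ) ∣ c i) :
    diagSum p (k + 1) c 0 = ((p : ℂ) ^ (n - 1)) ^ k * (primZeros fun i => (c i : ZMod (p ^ 1))).card := by
  have h := diagSum_prime_pow_mul (k := 1) hp2 one_ne_zero hc 0 k
  simp only [Pi.zero_apply, mul_zero] at h
  rw [add_comm k 1]
  refine h.trans ?_
  congr 1
  simp [diagSum, primSum]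

end Lifting

/-! ### The sum of `diagSum` over small nonzero frequencies. -/

section Frequencies

variable {p n : ℕ} [Fact p.Prime]

theorem reduceHom_eq_zero_of_prime_mul {j : ℕ} {x : ZMod (p ^ (j + 1))}
    (h : (p : ZMod (p ^ (j + 1))) * x = 0) : reduceHom p j x = 0 := by
  have hx : x = (x.val : ZMod (p ^ (j + 1))) := (ZMod.natCast_zmod_val x).symm
  rw [hx] at h ⊢
  rw [← Nat.cast_mul, ZMod.natCast_eq_zero_iff] at h
  rw [map_natCast, ZMod.natCast_eq_zero_iff]
  exact Nat.dvd_of_mul_dvd_mul_left (Fact.out : p.Prime).pos ((pow_succ' p j).symm.dvd.trans h)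

/-- At primitive frequencies `diagSum` has square-root size, and is supported on the zeros of a
nondegenerate diagonal form. -/
theorem exists_diagSum_bound (hp2 : Odd p) (j : ℕ) {c : Fin n → ℤ} (hc : ∀ i, ¬ (p : ℤ) ∣ c i) :
    ∃ μ : Fin n → ZMod (p ^ j), (∀ i, IsUnit (μ i)) ∧ ∀ y : Fin n → ℤ, (∃ i, ¬ (p : ℤ) ∣ y i) →
      ‖diagSum p (j + 1) c y‖ ≤ (p : ℝ) ^ n * √((p : ℝ) ^ (j + 1)) ^ n ∧
      (diagSum p (j + 1) c y ≠ 0 → ∑ i, μ i * (y i : ZMod (p ^ j)) ^ 2 = 0) := by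
  have h4 : ∀ i, ∃ d, 4 * (c i : ZMod (p ^ (j + 1))) * d = 1 := by
    intro i
    have h := isUnit_two_mul_intCast (k := j + 1) hp2 (hc i)
    have h2 := (isUnit_of_mul_isUnit_left h).mul h
    rw [show (2 : ZMod (p ^ (j + 1))) * (2 * (c i : ZMod (p ^ (j + 1)))) = 4 * c i by ring] at h2
    exact h2.exists_right_inv
  choose d hd using h4
  -- The dual coefficients `1 / (4 * c i)`, taken modulo `p ^ j`: the support condition modulo `p ^
  -- (j + 1)` carries an extra factor `p`.
  refine ⟨fun i => reduceHom p j (d i), fun i => ?_, fun y hy => ?_⟩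
  · exact (IsUnit.of_mul_eq_one_right _ (hd i)).map _
  · obtain ⟨i, hi⟩ := hy
    obtain ⟨h1, h2⟩ := norm_primSum_le_of_primitive hp2 (Nat.succ_pos j) hd
      (y := fun i => (y i : ZMod (p ^ (j + 1)))) ⟨i, isUnit_intCast_of_not_dvd hi⟩
    refine ⟨h1, fun hne => ?_⟩
    by_contra hne'
    refine hne (h2 fun h0 => hne' ?_)
    have h3 := reduceHom_eq_zero_of_prime_mul h0
    rw [map_sum] at h3
    simpa only [map_mul, map_pow, map_intCast] using h3

theorem exists_eq_prime_pow_mul {B : Fin n → ℤ} (hB : B ≠ 0) :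
    ∃ ν : ℕ, ∃ B' : Fin n → ℤ, (B = fun i => (p : ℤ) ^ ν * B' i) ∧ ∃ i, ¬ (p : ℤ) ∣ B' i := by
  classical
  obtain ⟨i₀, hi₀⟩ := Function.ne_iff.mp hB
  have hp : p.Prime := Fact.out
  have hfin : ∃ ν : ℕ, ¬ ∀ i, (p : ℤ) ^ (ν + 1) ∣ B i := by
    refine ⟨(B i₀).natAbs, fun h => ?_⟩
    have h1 := Nat.le_of_dvd (Int.natAbs_pos.mpr hi₀) (Int.natAbs_dvd_natAbs.mpr (h i₀))
    rw [Int.natAbs_pow, Int.natAbs_natCast] at h1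
    have h2 := Nat.lt_pow_self hp.one_lt (n := (B i₀).natAbs + 1)
    omega
  set ν := Nat.find hfin
  have h1 : ∀ i, (p : ℤ) ^ ν ∣ B i := by
    rcases Nat.eq_zero_or_pos ν with h0 | h0
    · intro i; rw [h0, pow_zero]; exact one_dvd _
    · have := Nat.find_min hfin (m := ν - 1) (by omega)
      rw [not_not, Nat.sub_add_cancel h0] at this
      exact this
  choose B' hB' using h1
  refine ⟨ν, B', funext hB', ?_⟩
  by_contra hcon
  push Not at hcon
  refine Nat.find_spec hfin fun i => ?_
  rw [hB' i, pow_succ]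
  exact mul_dvd_mul_left _ (hcon i)

/-- The total size of `diagSum` over small frequencies exactly divisible by `p ^ ν`. -/
theorem sum_norm_diagSum_fiber_le (hp2 : Odd p) (hn : 4 ≤ n) {ε : ℝ} (hε : 0 < ε) :
    ∃ C : ℝ, 0 < C ∧ ∀ ν j : ℕ, ∀ c : Fin n → ℤ, (∀ i, ¬ (p : ℤ) ∣ c i) →
      ∀ S : Finset (Fin n → ℤ), (∀ B ∈ S, (∃ B' : Fin n → ℤ, (B = fun i => (p : ℤ) ^ ν * B' i) ∧
        ∃ i, ¬ (p : ℤ) ∣ B' i) ∧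
        ∀ i, |(B i : ℝ)| ≤ ((p : ℝ) ^ (j + 1 + ν)) ^ (1 / 2 - ε / 2)) →
      ∑ B ∈ S, ‖diagSum p (j + 1 + ν) c B‖ ≤
        C * (((p : ℝ) ^ (j + 1 + ν)) ^ (n - 1) * ((p : ℝ) ^ (j + 1 + ν)) ^ (-(ε / 2))) := by
  classical
  obtain ⟨l, rfl⟩ := Nat.exists_eq_add_of_le' hn
  obtain ⟨C, hC, hcount⟩ := card_diag_zmod_le (half_pos hε) p l
  have hp1 : (1 : ℝ) ≤ p := by exact_mod_cast (Fact.out : p.Prime).one_le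
  refine ⟨(p : ℝ) ^ (l + 4) * C, by positivity, fun ν j c hc S hS => ?_⟩
  set q : ℝ := (p : ℝ) ^ (j + 1 + ν) with hq
  have hq1 : 1 ≤ q := one_le_pow₀ hp1
  set T : ℝ := q ^ (1 / 2 - ε / 2)
  have hT0 : 0 < T := by positivity
  set s : ℝ := √((p : ℝ) ^ (j + 1)) with hs
  have hs0 : 0 < s := by positivity
  have hTq : T ≤ q := by
    calc T ≤ q ^ (1 : ℝ) := Real.rpow_le_rpow_of_exponent_le hq1 (by linarith)
      _ = q := Real.rpow_one q
  -- After division by `p ^ ν` the box is still shorter than the square root of the reduced modulus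
  -- by `q ^ (-(ε / 2))`.
  have hTs : T / (p : ℝ) ^ ν ≤ s * q ^ (-(ε / 2)) := by
    have h1 : T = √q * q ^ (-(ε / 2)) := by
      rw [Real.sqrt_eq_rpow, ← Real.rpow_add (by positivity)]
      congr 1
    have h2 : √q ≤ s * (p : ℝ) ^ ν := by
      rw [hq, pow_add, Real.sqrt_mul (by positivity)]
      gcongr
      rw [Real.sqrt_le_left (by positivity)]
      exact le_self_pow₀ (one_le_pow₀ hp1) two_ne_zero
    rw [div_le_iff₀ (by positivity), h1]
    calc √q * q ^ (-(ε / 2)) ≤ (s * (p : ℝ) ^ ν) * q ^ (-(ε / 2)) := by gcongr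
      _ = _ := by ring
  have hqε : q ^ (-(ε / 2)) ≤ 1 := Real.rpow_le_one_of_one_le_of_nonpos hq1 (by linarith)
  obtain ⟨μ, hμ, hbound⟩ := exists_diagSum_bound hp2 j hc
  set Y := ⌊T / (p : ℝ) ^ ν⌋₊ with hY
  have hYT : (Y : ℝ) ≤ T / (p : ℝ) ^ ν := Nat.floor_le (by positivity)
  have hYK : Y ^ 2 ≤ p * p ^ j := by
    have : (Y : ℝ) ^ 2 ≤ (p : ℝ) * p ^ j := by
      calc (Y : ℝ) ^ 2 ≤ (s * 1) ^ 2 := by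
            gcongr
            exact hYT.trans (hTs.trans (by gcongr))
        _ = _ := by rw [mul_one, hs, Real.sq_sqrt (by positivity), pow_succ']
    exact_mod_cast this
  have hbox : ∀ B' : Fin (l + 4) → ℤ, (∀ i, |(((p : ℤ) ^ ν * B' i : ℤ) : ℝ)| ≤ T) →
      B' ∈ intBox (l + 4) Y := by
    intro B' h
    rw [intBox, Fintype.mem_piFinset]
    intro i
    rw [Finset.mem_Icc, ← abs_le, Int.abs_eq_natAbs]
    norm_cast
    rw [hY]
    refine Nat.le_floor ?_
    rw [le_div_iff₀ (by positivity)]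
    have := h i
    push_cast at this
    rw [abs_mul, abs_of_pos (by positivity : (0 : ℝ) < (p : ℝ) ^ ν)] at this
    rw [Nat.cast_natAbs]
    push_cast
    linarith
  rcases Nat.eq_zero_or_pos Y with hY0 | hY0
  · have : S = ∅ := by
      refine Finset.eq_empty_of_forall_notMem fun B hB => ?_
      obtain ⟨⟨B', rfl, i, hi⟩, hT⟩ := hS B hB
      have := hbox B' hT
      rw [intBox, Fintype.mem_piFinset] at this
      have h0 := this i
      rw [hY0, Finset.mem_Icc] at h0
      apply hi
      rw [show B' i = 0 by push_cast at h0; omega]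
      exact dvd_zero _
    rw [this, Finset.sum_empty]
    positivity
  set M : ℝ := ((p : ℝ) ^ (l + 4 - 1)) ^ ν * ((p : ℝ) ^ (l + 4) * s ^ (l + 4))
  have hval : ∀ B', diagSum p (j + 1 + ν) c (fun i => (p : ℤ) ^ ν * B' i) =
      ((p : ℂ) ^ (l + 4 - 1)) ^ ν * diagSum p (j + 1) c B' := fun B' =>
    diagSum_prime_pow_mul hp2 (Nat.succ_ne_zero j) hc B' ν
  have hle : ∑ B ∈ S, ‖diagSum p (j + 1 + ν) c B‖ ≤
      ((S.filter fun B => diagSum p (j + 1 + ν) c B ≠ 0).card : ℝ) * M := by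
    rw [← nsmul_eq_mul, ← Finset.sum_const, Finset.sum_filter]
    refine Finset.sum_le_sum fun B hB => ?_
    obtain ⟨⟨B', rfl, hi⟩, hT⟩ := hS B hB
    split_ifs with h
    · rw [hval, norm_mul, norm_pow, norm_pow, Complex.norm_natCast]
      exact mul_le_mul_of_nonneg_left (hbound B' hi).1 (by positivity)
    · rw [not_not] at h
      rw [h, norm_zero]
  have hcard : ((S.filter fun B => diagSum p (j + 1 + ν) c B ≠ 0).card : ℝ) ≤
      C * (Y : ℝ) ^ (l + 2) * (Y : ℝ) ^ (ε / 2) := by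
    refine le_trans ?_ (hcount Y hY0 (p ^ j) (pow_pos (Fact.out : p.Prime).pos j) hYK μ hμ 0)
    rw [Nat.cast_le]
    refine Finset.card_le_card_of_injOn (fun B i => B i / (p : ℤ) ^ ν) ?_ ?_
    · intro B hB
      rw [Finset.mem_coe, Finset.mem_filter] at hB
      obtain ⟨⟨B', rfl, hi⟩, hT⟩ := hS B hB.1
      have hdiv : (fun i => (p : ℤ) ^ ν * B' i / (p : ℤ) ^ ν) = B' := by
        funext i
        exact Int.mul_ediv_cancel_left _
          (pow_ne_zero _ (Nat.cast_ne_zero.mpr (Fact.out : p.Prime).ne_zero))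
      change (fun i => (p : ℤ) ^ ν * B' i / (p : ℤ) ^ ν) ∈ _
      rw [Finset.mem_coe, hdiv, Finset.mem_filter]
      refine ⟨hbox B' hT, (hbound B' hi).2 fun h0 => hB.2 ?_⟩
      rw [hval, h0, mul_zero]
    · intro B hB D hD h
      rw [Finset.mem_coe, Finset.mem_filter] at hB hD
      obtain ⟨⟨B', hB', _⟩, _⟩ := hS B hB.1
      obtain ⟨⟨D', hD', _⟩, _⟩ := hS D hD.1
      funext i
      have h := congrFun h i
      have h1 : (p : ℤ) ^ ν ∣ B i := by rw [hB']; exact dvd_mul_right _ _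
      have h2 : (p : ℤ) ^ ν ∣ D i := by rw [hD']; exact dvd_mul_right _ _
      rw [← Int.mul_ediv_cancel' h1, ← Int.mul_ediv_cancel' h2]
      exact congrArg _ h
  -- Two of the `l + 2` factors already save `q ^ (-ε)`; the divisor bound gives back only `q ^ (ε /
  -- 2)`.
  have hY1 : (Y : ℝ) ^ (l + 2) ≤ s ^ (l + 2) * q ^ (-ε) := by
    calc (Y : ℝ) ^ (l + 2) ≤ (s * q ^ (-(ε / 2))) ^ (l + 2) := by
          gcongr; exact hYT.trans hTs
      _ = s ^ (l + 2) * (q ^ (-(ε / 2))) ^ (l + 2) := mul_pow _ _ _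
      _ ≤ s ^ (l + 2) * (q ^ (-(ε / 2))) ^ 2 := by
          gcongr ?_ * ?_
          exact pow_le_pow_of_le_one (by positivity) hqε (by omega)
      _ = _ := by
          rw [← Real.rpow_natCast (q ^ (-(ε / 2))), ← Real.rpow_mul (by positivity)]
          congr 2
          push_cast
          ring
  have hY2 : (Y : ℝ) ^ (ε / 2) ≤ q ^ (ε / 2) := by
    refine Real.rpow_le_rpow (by positivity) ?_ (by positivity)
    calc (Y : ℝ) ≤ T / (p : ℝ) ^ ν := hYT
      _ ≤ T := div_le_self hT0.le (one_le_pow₀ hp1)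
      _ ≤ q := hTq
  calc _ ≤ (C * (Y : ℝ) ^ (l + 2) * (Y : ℝ) ^ (ε / 2)) * M := hle.trans (by gcongr)
    _ ≤ (C * (s ^ (l + 2) * q ^ (-ε)) * q ^ (ε / 2)) * M := by gcongr
    _ = (p : ℝ) ^ (l + 4) * C * ((s ^ 2) ^ (l + 3) * ((p : ℝ) ^ (l + 3)) ^ ν *
          (q ^ (-ε) * q ^ (ε / 2))) := by
        simp only [M, show l + 4 - 1 = l + 3 from rfl]
        ring
    _ = _ := by
        rw [← Real.rpow_add (by positivity), hs, Real.sq_sqrt (by positivity), hq,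
          show l + 4 - 1 = l + 3 from rfl, show -ε + ε / 2 = -(ε / 2) by ring]
        ring

/-- The total size of `diagSum` over small nonzero frequencies is of lower order. -/
theorem exists_sum_norm_diagSum_le (hp2 : Odd p) (hn : 4 ≤ n) {ε κ : ℝ} (hε : 0 < ε)
    (hκ : 0 < κ) :
    ∃ m₀ : ℕ, ∀ m : ℕ, m₀ ≤ m → ∀ c : Fin n → ℤ, (∀ i, ¬ (p : ℤ) ∣ c i) →
      ∀ S : Finset (Fin n → ℤ), (∀ B ∈ S, B ≠ 0 ∧
        ∀ i, |(B i : ℝ)| ≤ ((p : ℝ) ^ m) ^ (1 / 2 - ε / 2)) →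
      ∑ B ∈ S, ‖diagSum p m c B‖ ≤ κ * ((p : ℝ) ^ m) ^ (n - 1) := by
  classical
  obtain ⟨C, hC, hfib⟩ := sum_norm_diagSum_fiber_le (p := p) hp2 hn hε
  have hp1 : (1 : ℝ) < p := by exact_mod_cast (Fact.out : p.Prime).one_lt
  have hlim : Filter.Tendsto (fun m : ℕ => (m : ℝ) * ((p : ℝ) ^ (-(ε / 2))) ^ m) Filter.atTop
      (nhds 0) :=
    tendsto_self_mul_const_pow_of_lt_one (by positivity)
      (Real.rpow_lt_one_of_one_lt_of_neg hp1 (by linarith))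
  obtain ⟨m₀, hm₀⟩ := Filter.eventually_atTop.mp (hlim.eventually_lt_const (div_pos hκ hC))
  refine ⟨max m₀ 1, fun m hm c hc S hS => ?_⟩
  have hm1 : 1 ≤ m := (le_max_right _ _).trans hm
  specialize hm₀ m ((le_max_left _ _).trans hm)
  set q : ℝ := (p : ℝ) ^ m with hq
  have hq1 : 1 < q := one_lt_pow₀ hp1 (by omega)
  have hdec : ∀ B : Fin n → ℤ, ∃ ν : ℕ, B ≠ 0 →
      ∃ B' : Fin n → ℤ, (B = fun i => (p : ℤ) ^ ν * B' i) ∧ ∃ i, ¬ (p : ℤ) ∣ B' i := by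
    intro B
    by_cases hB : B = 0
    · exact ⟨0, fun h => absurd hB h⟩
    · obtain ⟨ν, h⟩ := exists_eq_prime_pow_mul (p := p) hB
      exact ⟨ν, fun _ => h⟩
  choose v hv using hdec
  -- A nonzero coordinate smaller than `q` is not divisible by `p ^ m`. So there are only `m`
  -- classes, and `m * q ^ (-(ε / 2))` tends to zero.
  have hmaps : ∀ B ∈ S, v B ∈ Finset.range m := by
    intro B hB
    obtain ⟨hB0, hT⟩ := hS B hB
    obtain ⟨B', hB', i, hi⟩ := hv B hB0
    have h1 := hT i
    have h2 : q ^ (1 / 2 - ε / 2) < q := by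
      calc q ^ (1 / 2 - ε / 2) < q ^ (1 : ℝ) :=
            Real.rpow_lt_rpow_of_exponent_lt hq1 (by linarith)
        _ = q := Real.rpow_one q
    rw [Finset.mem_range]
    by_contra hlt
    have h3 : (p : ℝ) ^ m ≤ |(B i : ℝ)| := by
      rw [hB']
      push_cast
      rw [abs_mul, abs_of_pos (by positivity : (0 : ℝ) < (p : ℝ) ^ v B)]
      have h4 : (1 : ℝ) ≤ |(B' i : ℝ)| := by
        have : B' i ≠ 0 := fun h => hi (h ▸ dvd_zero _)
        exact_mod_cast Int.one_le_abs this
      calc (p : ℝ) ^ m ≤ (p : ℝ) ^ v B := pow_le_pow_right₀ hp1.le (not_lt.mp hlt)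
        _ ≤ _ := le_mul_of_one_le_right (by positivity) h4
    linarith
  rw [← Finset.sum_fiberwise_of_maps_to hmaps]
  calc _ ≤ ∑ ν ∈ Finset.range m, C * (q ^ (n - 1) * q ^ (-(ε / 2))) := by
        refine Finset.sum_le_sum fun ν hν => ?_
        rw [Finset.mem_range] at hν
        obtain ⟨j, hj⟩ : ∃ j, m = j + 1 + ν := ⟨m - 1 - ν, by omega⟩
        have h := hfib ν j c hc (S.filter fun B => v B = ν) (fun B hB => by
          rw [Finset.mem_filter] at hB
          obtain ⟨hB0, hT⟩ := hS B hB.1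
          have := hv B hB0
          rw [hB.2] at this
          refine ⟨this, fun i => ?_⟩
          rw [← hj]
          exact hT i)
        rw [hq]
        subst hj
        exact h
    _ = C * (m * ((p : ℝ) ^ (-(ε / 2))) ^ m) * q ^ (n - 1) := by
        rw [Finset.sum_const, Finset.card_range, nsmul_eq_mul,
          show q ^ (-(ε / 2)) = ((p : ℝ) ^ (-(ε / 2))) ^ m by
            rw [hq, ← Real.rpow_natCast, ← Real.rpow_natCast, ← Real.rpow_mul (by positivity),
              ← Real.rpow_mul (by positivity), mul_comm]]
        ring
    _ ≤ κ * q ^ (n - 1) := by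
        gcongr
        rw [lt_div_iff₀ hC] at hm₀
        linarith

end Frequencies

/-! ### Poisson summation and the dual weight. -/

/-- A real Schwartz function, regarded as a complex one. -/
noncomputable def complexify (Φ : 𝓢(ℝ, ℝ)) : 𝓢(ℝ, ℂ) :=
  SchwartzMap.postcompCLM (𝕜 := ℝ) Complex.ofRealCLM Φ

theorem complexify_apply (Φ : 𝓢(ℝ, ℝ)) (x : ℝ) : complexify Φ x = (Φ x : ℂ) := rfl

/-- The dilate `x ↦ f (N x)` of a Schwartz function. -/
noncomputable def schwartzDilate (f : 𝓢(ℝ, ℂ)) (N : ℝ) (hN : N ≠ 0) : 𝓢(ℝ, ℂ) :=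
  SchwartzMap.compCLMOfContinuousLinearEquiv ℝ
    (ContinuousLinearEquiv.unitsEquivAut ℝ (Units.mk0 N hN)) f

theorem schwartzDilate_apply (f : 𝓢(ℝ, ℂ)) (N : ℝ) (hN : N ≠ 0) (x : ℝ) :
    schwartzDilate f N hN x = f (N * x) := by
  rw [mul_comm]; rfl

theorem fourier_schwartzDilate (f : 𝓢(ℝ, ℂ)) {N : ℝ} (hN : 0 < N) (y : ℝ) :
    𝓕 (schwartzDilate f N hN.ne') y = (N : ℂ)⁻¹ * 𝓕 f (y / N) := by
  rw [SchwartzMap.fourier_coe, SchwartzMap.fourier_coe, Real.fourier_real_eq_integral_exp_smul,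
    Real.fourier_real_eq_integral_exp_smul]
  have h := MeasureTheory.Measure.integral_comp_mul_left
    (fun v : ℝ => Complex.exp (↑(-2 * Real.pi * v * (y / N)) * Complex.I) • f v) N
  rw [abs_of_pos (inv_pos.mpr hN)] at h
  rw [show (N : ℂ)⁻¹ * ∫ v : ℝ, Complex.exp (↑(-2 * Real.pi * v * (y / N)) * Complex.I) • f v =
    N⁻¹ • ∫ v : ℝ, Complex.exp (↑(-2 * Real.pi * v * (y / N)) * Complex.I) • f v by
      rw [Complex.real_smul]; push_cast; rfl, ← h]
  congr 1
  funext v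
  rw [schwartzDilate_apply]
  congr 4
  field_simp

theorem fourier_fourier_apply (f : 𝓢(ℝ, ℂ)) (x : ℝ) : 𝓕 (𝓕 f) x = f (-x) := by
  have h : 𝓕⁻ (𝓕 f) = f := FourierTransform.fourierInv_fourier_eq f
  rw [← h, SchwartzMap.fourierInv_coe, Real.fourierInv_eq_fourier_neg, neg_neg, h]
  rfl

/-- Poisson summation for a dilate, at a shifted frequency. -/
theorem tsum_mul_exp_eq (f : 𝓢(ℝ, ℂ)) {N : ℝ} (hN : 0 < N) (θ : ℝ) :
    ∑' x : ℤ, f (x / N) * Complex.exp (-(2 * Real.pi * Complex.I * x * θ)) =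
      N * ∑' k : ℤ, 𝓕 f (N * (θ + k)) := by
  -- Poisson is applied to the dilated transform, so that the double transform returns `f (-x)`; the
  -- sign is removed by `x ↦ -x`.
  have h := SchwartzMap.tsum_eq_tsum_fourier (schwartzDilate (𝓕 f) N hN.ne') θ
  simp only [schwartzDilate_apply, fourier_schwartzDilate _ hN, fourier_fourier_apply,
    fourier_coe_apply] at h
  rw [h, ← tsum_mul_left, ← Equiv.tsum_eq (Equiv.neg ℤ)]
  refine tsum_congr fun x => ?_
  have : (N : ℂ) ≠ 0 := by exact_mod_cast hN.ne'
  rw [mul_assoc (N : ℂ)⁻¹, mul_inv_cancel_left₀ this]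
  simp only [Equiv.neg_apply]
  push_cast
  congr 2 <;> ring

/-- The dual weight: the periodization of the Fourier transform. -/
noncomputable def dualWeight (f : 𝓢(ℝ, ℂ)) (N θ : ℝ) : ℂ := ∑' k : ℤ, 𝓕 f (N * (θ + k))

theorem exists_norm_le_one_add_pow (f : 𝓢(ℝ, ℂ)) (L : ℕ) :
    ∃ C : ℝ, 0 < C ∧ ∀ x : ℝ, ‖f x‖ * (1 + |x|) ^ L ≤ C := by
  refine ⟨2 ^ L * (Finset.Iic (L, 0)).sup (fun m => SchwartzMap.seminorm ℝ m.1 m.2) f + 1, ?_, ?_⟩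
  · have : 0 ≤ (Finset.Iic (L, 0)).sup (fun m => SchwartzMap.seminorm ℝ (E := ℝ) (F := ℂ) m.1 m.2) f :=
      apply_nonneg _ _
    positivity
  · intro x
    have h := SchwartzMap.one_add_le_sup_seminorm_apply (𝕜 := ℝ) (m := (L, 0)) (le_refl L)
      (le_refl 0) f x
    rw [norm_iteratedFDeriv_zero, Real.norm_eq_abs] at h
    linarith

theorem summable_one_add_half_abs : Summable fun k : ℤ => ((1 + |(k : ℝ)| / 2) ^ 2)⁻¹ := by
  have h : Summable fun k : ℤ => 4 * (1 / (k : ℝ) ^ 2) :=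
    (Real.summable_one_div_int_pow.mpr one_lt_two).mul_left 4
  refine Summable.of_norm_bounded_eventually h ?_
  refine (Set.finite_singleton (0 : ℤ)).subset fun k hk => ?_
  by_contra hne
  apply hk
  have hk0 : (0 : ℝ) < |(k : ℝ)| := abs_pos.mpr (Int.cast_ne_zero.mpr hne)
  change ‖_‖ ≤ _
  rw [Real.norm_of_nonneg (by positivity), ← sq_abs (k : ℝ), one_div,
    show (4 : ℝ) * (|(k : ℝ)| ^ 2)⁻¹ = ((|(k : ℝ)| / 2) ^ 2)⁻¹ by field_simp; norm_num]
  gcongr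
  linarith

/-- Rapid decay of the dual weight. -/
theorem exists_norm_dualWeight_le (f : 𝓢(ℝ, ℂ)) (L : ℕ) : ∃ C : ℝ, 0 < C ∧
    ∀ N θ : ℝ, 1 ≤ N → |θ| ≤ 1 / 2 → ‖dualWeight f N θ‖ * (1 + N * |θ|) ^ L ≤ C := by
  -- `L` powers give the decay in `θ`, two more the convergence over `k`; both are available because
  -- `|θ| ≤ 1 / 2` forces `|θ + k|` to be at least `|θ|` and `|k| / 2`.
  obtain ⟨C, hC, h⟩ := exists_norm_le_one_add_pow (𝓕 f) (L + 2)
  set s : ℤ → ℝ := fun k => ((1 + |(k : ℝ)| / 2) ^ 2)⁻¹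
  have hs : Summable s := summable_one_add_half_abs
  have hs0 : 0 ≤ ∑' k, s k := tsum_nonneg fun k => by positivity
  refine ⟨C * (∑' k, s k) + 1, by positivity, fun N θ hN hθ => ?_⟩
  have hA : 0 < (1 + N * |θ|) ^ L := by positivity
  have hterm : ∀ k : ℤ, ‖𝓕 f (N * (θ + k))‖ ≤ C * ((1 + N * |θ|) ^ L)⁻¹ * s k := by
    intro k
    have h1 : |θ| ≤ |θ + k| ∧ |(k : ℝ)| / 2 ≤ |θ + k| := by
      by_cases hk : k = 0
      · simp [hk]
      · have hk1 : (1 : ℝ) ≤ |(k : ℝ)| := by exact_mod_cast Int.one_le_abs hk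
        have h2 : |(k : ℝ)| ≤ |θ + k| + |θ| := by
          have := abs_sub (θ + k) θ
          rwa [add_sub_cancel_left] at this
        constructor <;> linarith
    have h2 : (1 + N * |θ|) ^ L * (1 + |(k : ℝ)| / 2) ^ 2 ≤ (1 + |N * (θ + k)|) ^ (L + 2) := by
      rw [abs_mul, abs_of_pos (by linarith : 0 < N), pow_add]
      have h5 := h1.2.trans (le_mul_of_one_le_left (abs_nonneg _) hN)
      have h6 := h1.1
      gcongr ?_ * ?_
      · exact pow_le_pow_left₀ (by positivity) (by gcongr) _
      · exact pow_le_pow_left₀ (by positivity) (by linarith) _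
    have h3 : ‖𝓕 f (N * (θ + k))‖ * ((1 + N * |θ|) ^ L * (1 + |(k : ℝ)| / 2) ^ 2) ≤ C :=
      (mul_le_mul_of_nonneg_left h2 (norm_nonneg _)).trans (h _)
    have h4 : 0 < (1 + N * |θ|) ^ L * (1 + |(k : ℝ)| / 2) ^ 2 := by positivity
    rw [mul_assoc, ← mul_inv, ← div_eq_mul_inv, le_div_iff₀ h4]
    exact h3
  have hsum : Summable fun k => C * ((1 + N * |θ|) ^ L)⁻¹ * s k := hs.mul_left _
  have := tsum_of_norm_bounded hsum.hasSum hterm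
  rw [tsum_mul_left] at this
  calc ‖dualWeight f N θ‖ * (1 + N * |θ|) ^ L
      ≤ (C * ((1 + N * |θ|) ^ L)⁻¹ * ∑' k, s k) * (1 + N * |θ|) ^ L := by
        gcongr; exact this
    _ = C * ∑' k, s k := by field_simp
    _ ≤ _ := by linarith

/-- The dual weight at frequency zero tends to the Fourier transform at zero. -/
theorem exists_norm_dualWeight_zero_sub_le (f : 𝓢(ℝ, ℂ)) : ∃ C : ℝ, 0 < C ∧
    ∀ N : ℝ, 1 ≤ N → ‖dualWeight f N 0 - 𝓕 f 0‖ ≤ C / N := by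
  -- One power yields the factor `1 / N`, two the convergence over `k`.
  obtain ⟨C, hC, h⟩ := exists_norm_le_one_add_pow (𝓕 f) 3
  set s : ℤ → ℝ := fun k => ((1 + |(k : ℝ)| / 2) ^ 2)⁻¹
  have hs : Summable s := summable_one_add_half_abs
  have hs0 : 0 ≤ ∑' k, s k := tsum_nonneg fun k => by positivity
  refine ⟨C * (∑' k, s k) + 1, by positivity, fun N hN => ?_⟩
  have hN0 : 0 < N := by linarith
  have hterm : ∀ k : ℤ, k ≠ 0 → ‖𝓕 f (N * (0 + k))‖ ≤ C / N * s k := by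
    intro k hk
    have hk1 : (1 : ℝ) ≤ |(k : ℝ)| := by exact_mod_cast Int.one_le_abs hk
    have h1 : N * |(k : ℝ)| ≥ N := by nlinarith
    have h2 : N * (1 + |(k : ℝ)| / 2) ^ 2 ≤ (1 + |N * (0 + k)|) ^ 3 := by
      rw [zero_add, abs_mul, abs_of_pos hN0]
      calc N * (1 + |(k : ℝ)| / 2) ^ 2
          ≤ (1 + N * |(k : ℝ)|) * (1 + N * |(k : ℝ)|) ^ 2 := by
            refine mul_le_mul (by linarith) (pow_le_pow_left₀ (by positivity) ?_ 2)
              (by positivity) (by positivity)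
            nlinarith
        _ = _ := by ring
    have h3 : ‖𝓕 f (N * (0 + k))‖ * (N * (1 + |(k : ℝ)| / 2) ^ 2) ≤ C :=
      (mul_le_mul_of_nonneg_left h2 (norm_nonneg _)).trans (h _)
    have h4 : 0 < N * (1 + |(k : ℝ)| / 2) ^ 2 := by positivity
    rw [div_eq_mul_inv, mul_assoc, ← mul_inv, ← div_eq_mul_inv, le_div_iff₀ h4]
    exact h3
  have hsumm : Summable fun k : ℤ => 𝓕 f (N * (0 + k)) := by
    refine Summable.of_norm_bounded_eventually (hs.mul_left (C / N)) ?_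
    refine (Set.finite_singleton (0 : ℤ)).subset fun k hk => ?_
    by_contra hne
    exact hk (hterm k hne)
  have hsplit : dualWeight f N 0 - 𝓕 f 0 =
      ∑' k : ℤ, if k = 0 then 0 else 𝓕 f (N * (0 + k)) := by
    rw [dualWeight, hsumm.tsum_eq_add_tsum_ite 0]
    simp
  have hsum : Summable fun k => C / N * s k := hs.mul_left _
  rw [hsplit]
  have := tsum_of_norm_bounded (f := fun k : ℤ => if k = 0 then 0 else 𝓕 f (N * (0 + k)))
    hsum.hasSum (fun k => by
      split_ifs with hk
      · rw [norm_zero]; positivity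
      · exact hterm k hk)
  rw [tsum_mul_left] at this
  refine this.trans ?_
  rw [div_mul_eq_mul_div]
  gcongr
  linarith

theorem summable_schwartz_div (f : 𝓢(ℝ, ℂ)) {N : ℝ} (hN : 0 < N) :
    Summable fun x : ℤ => ‖f (x / N)‖ := by
  have h := (schwartzDilate f N⁻¹ (inv_ne_zero hN.ne')).isBigO_cocompact_rpow (-2)
  have h2 := summable_of_isBigO (Real.summable_abs_int_rpow one_lt_two)
    (h.norm_left.comp_tendsto Int.tendsto_coe_cofinite)
  refine h2.congr fun x => ?_
  simp only [Function.comp_apply]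
  rw [schwartzDilate_apply, inv_mul_eq_div]

open Classical in
/-- The sum of `f (x / N)` over a residue class, as a finite Fourier expansion. -/
theorem tsum_residue_class_eq (f : 𝓢(ℝ, ℂ)) {N : ℝ} (hN : 0 < N) {q : ℕ} [NeZero q] (a : ZMod q) :
    ∑' x : ℤ, (if (x : ZMod q) = a then f (x / N) else 0) =
      ∑ b : ZMod q, (N / q * dualWeight f N (b.valMinAbs / q)) * ZMod.stdAddChar (a * b) := by
  have hq : (q : ℂ) ≠ 0 := Nat.cast_ne_zero.mpr (NeZero.ne q)
  have hchar : ∀ (x : ℤ) (b : ZMod q),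
      Complex.exp (-(2 * Real.pi * Complex.I * x * ((b.valMinAbs / q : ℝ) : ℂ))) =
        ZMod.stdAddChar (-((x : ZMod q) * b)) := by
    intro x b
    conv_rhs => rw [← b.coe_valMinAbs]
    rw [show -((x : ZMod q) * (b.valMinAbs : ZMod q)) = ((-(x * b.valMinAbs) : ℤ) : ZMod q) by
      push_cast; rfl, ZMod.stdAddChar_coe]
    congr 1
    push_cast
    ring
  have hpois : ∀ b : ZMod q, N * dualWeight f N (b.valMinAbs / q) =
      ∑' x : ℤ, f (x / N) * ZMod.stdAddChar (-((x : ZMod q) * b)) := by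
    intro b
    rw [dualWeight, ← tsum_mul_exp_eq f hN]
    exact tsum_congr fun x => by rw [hchar]
  have hsumm : ∀ b : ZMod q, Summable fun x : ℤ =>
      f (x / N) * ZMod.stdAddChar (-((x : ZMod q) * b)) := by
    intro b
    refine Summable.of_norm ((summable_schwartz_div f hN).congr fun x => ?_)
    rw [norm_mul, AddChar.norm_apply, mul_one]
  have hpt : ∀ x : ℤ, (if (x : ZMod q) = a then f (x / N) else 0) =
      ∑ b : ZMod q, (q : ℂ)⁻¹ *
        (f (x / N) * ZMod.stdAddChar (-((x : ZMod q) * b)) * ZMod.stdAddChar (a * b)) := by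
    intro x
    have h : ∑ b : ZMod q, ZMod.stdAddChar (b * (a - (x : ZMod q))) =
        ((if a - (x : ZMod q) = 0 then Fintype.card (ZMod q) else 0 : ℕ) : ℂ) :=
      AddChar.sum_mulShift _ (ZMod.isPrimitive_stdAddChar q)
    rw [ZMod.card] at h
    have h2 : ∀ b : ZMod q, (q : ℂ)⁻¹ * (f (x / N) * ZMod.stdAddChar (-((x : ZMod q) * b)) *
        ZMod.stdAddChar (a * b)) =
          (q : ℂ)⁻¹ * f (x / N) * ZMod.stdAddChar (b * (a - (x : ZMod q))) := by
      intro b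
      rw [mul_assoc (f _), ← AddChar.map_add_eq_mul, mul_assoc]
      congr 3
      ring
    rw [Finset.sum_congr rfl fun b _ => h2 b, ← Finset.mul_sum, h]
    by_cases hx : (x : ZMod q) = a
    · rw [if_pos hx, if_pos (by rw [hx, sub_self])]
      field_simp
    · rw [if_neg hx, if_neg (fun h => hx (sub_eq_zero.mp h).symm)]
      simp
  calc _ = ∑' x : ℤ, ∑ b : ZMod q, (q : ℂ)⁻¹ *
          (f (x / N) * ZMod.stdAddChar (-((x : ZMod q) * b)) * ZMod.stdAddChar (a * b)) :=
        tsum_congr hpt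
    _ = ∑ b : ZMod q, ∑' x : ℤ, (q : ℂ)⁻¹ *
          (f (x / N) * ZMod.stdAddChar (-((x : ZMod q) * b)) * ZMod.stdAddChar (a * b)) :=
        Summable.tsum_finsetSum fun b _ => ((hsumm b).mul_right _).mul_left _
    _ = _ := by
        refine Finset.sum_congr rfl fun b _ => ?_
        rw [tsum_mul_left, tsum_mul_right, ← hpois]
        ring

/-! ### The weighted count as a sum over dual frequencies. -/

theorem hasSum_mul_of_nonneg {α β : Type*} {f : α → ℝ} {g : β → ℝ} {a b : ℝ} (hf : HasSum f a)
    (hg : HasSum g b) (hf0 : ∀ x, 0 ≤ f x) (hg0 : ∀ y, 0 ≤ g y) :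
    HasSum (fun z : α × β => f z.1 * g z.2) (a * b) :=
  hf.mul hg (hf.summable.mul_of_nonneg hg.summable hf0 hg0)

/-- The sum of a product over `Fin n → ℤ` factors. -/
theorem hasSum_prod_fin {n : ℕ} (f : Fin n → ℤ → ℝ) (h0 : ∀ i x, 0 ≤ f i x)
    (hf : ∀ i, Summable (f i)) :
    HasSum (fun x : Fin n → ℤ => ∏ i, f i (x i)) (∏ i, ∑' x, f i x) := by
  induction n with
  | zero =>
    simpa only [Finset.univ_eq_empty, Finset.prod_empty] using
      hasSum_unique (fun _ : Fin 0 → ℤ => (1 : ℝ))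
  | succ n ih =>
    have h1 := ih (fun i => f i.succ) (fun i => h0 _) (fun i => hf _)
    have h2 := hasSum_mul_of_nonneg (hf 0).hasSum h1 (h0 0)
      fun x => Finset.prod_nonneg fun i _ => h0 i.succ (x i)
    rw [← (Fin.consEquiv fun _ : Fin (n + 1) => ℤ).hasSum_iff, Fin.prod_univ_succ]
    refine Eq.mpr (congrArg (HasSum · _) (funext fun x => ?_)) h2
    simp [Fin.prod_univ_succ, Fin.consEquiv]

section Assembly

variable {p m n : ℕ} [Fact p.Prime]

theorem isUnit_intCast_iff (hm : m ≠ 0) (a : ℤ) : IsUnit (a : ZMod (p ^ m)) ↔ ¬ (p : ℤ) ∣ a := by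
  refine ⟨fun h hd => ?_, isUnit_intCast_of_not_dvd⟩
  obtain ⟨b, rfl⟩ := hd
  push_cast at h
  exact not_isUnit_prime_mul hm _ h

theorem mem_congruenceSolutions_iff (hm : m ≠ 0) {c x : Fin n → ℤ} :
    x ∈ congruenceSolutions p m c ↔
      (fun i => (x i : ZMod (p ^ m))) ∈ primZeros fun i => (c i : ZMod (p ^ m)) := by
  rw [mem_primZeros, and_comm]
  refine and_congr ?_ ?_
  · rw [not_forall]
    refine exists_congr fun i => ?_
    rw [isUnit_intCast_iff hm, Int.modEq_zero_iff_dvd]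
  · rw [Int.modEq_zero_iff_dvd, ← Nat.cast_pow, ← ZMod.intCast_zmod_eq_zero_iff_dvd, diagForm]
    push_cast
    rfl

-- Membership depends only on residues modulo `p ^ m`, and over one residue class the weight factors
-- into one-variable sums.
open Classical in
theorem hasSum_boxWeight (hm : m ≠ 0) (c : Fin n → ℤ) {Φ : 𝓢(ℝ, ℝ)} (hΦ : ∀ t, 0 ≤ Φ t) {N : ℝ}
    (hN : 0 < N) :
    HasSum (fun x : congruenceSolutions p m c => boxWeight Φ N x.1)
      (∑ a ∈ primZeros fun i => (c i : ZMod (p ^ m)),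
        ∏ i, ∑' x : ℤ, if (x : ZMod (p ^ m)) = a i then Φ (x / N) else 0) := by
  have hs : Summable fun x : ℤ => Φ (x / N) := by
    refine (summable_schwartz_div (complexify Φ) hN).congr fun x => ?_
    rw [complexify_apply, Complex.norm_real, Real.norm_of_nonneg (hΦ _)]
  have h1 : ∀ a ∈ primZeros fun i => (c i : ZMod (p ^ m)),
      HasSum (fun x : Fin n → ℤ => ∏ i, if (x i : ZMod (p ^ m)) = a i then Φ (x i / N) else 0)
        (∏ i, ∑' x : ℤ, if (x : ZMod (p ^ m)) = a i then Φ (x / N) else 0) := by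
    intro a _
    refine hasSum_prod_fin (fun i x => if (x : ZMod (p ^ m)) = a i then Φ (x / N) else 0) ?_ ?_
    · intro i x
      split_ifs
      · exact hΦ _
      · exact le_refl _
    · intro i
      refine Summable.of_nonneg_of_le (fun x => ?_) (fun x => ?_) hs
      · split_ifs
        · exact hΦ _
        · exact le_refl _
      · split_ifs
        · exact le_refl _
        · exact hΦ _
  have h2 := hasSum_sum h1
  have h3 : HasSum ((congruenceSolutions p m c).indicator (boxWeight Φ N))
      (∑ a ∈ primZeros fun i => (c i : ZMod (p ^ m)),
        ∏ i, ∑' x : ℤ, if (x : ZMod (p ^ m)) = a i then Φ (x / N) else 0) := by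
    refine Eq.mpr (congrArg (HasSum · _) (funext fun x => ?_)) h2
    have hprod : ∀ a : Fin n → ZMod (p ^ m),
        (∏ i, if (x i : ZMod (p ^ m)) = a i then Φ (x i / N) else 0) =
          if a = (fun i => (x i : ZMod (p ^ m))) then boxWeight Φ N x else 0 := by
      intro a
      split_ifs with h
      · exact Finset.prod_congr rfl fun i _ => if_pos (congrFun h i).symm
      · obtain ⟨i, hi⟩ := Function.ne_iff.mp h
        exact Finset.prod_eq_zero (Finset.mem_univ i) (if_neg (Ne.symm hi))
    rw [Finset.sum_congr rfl fun a _ => hprod a, Finset.sum_ite_eq', Set.indicator_apply]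
    exact if_congr (mem_congruenceSolutions_iff hm) rfl rfl
  exact hasSum_subtype_iff_indicator.mpr h3

/-- The weighted count as a sum over dual frequencies. -/
theorem weightedCount_eq_sum (hm : m ≠ 0) (c : Fin n → ℤ) {Φ : 𝓢(ℝ, ℝ)} (hΦ : ∀ t, 0 ≤ Φ t)
    {N : ℝ} (hN : 0 < N) :
    (weightedCount p m c Φ N : ℂ) = ((N : ℂ) / (p : ℂ) ^ m) ^ n *
      ∑ b : Fin n → ZMod (p ^ m),
        (∏ i, dualWeight (complexify Φ) N ((b i).valMinAbs / ((p ^ m : ℕ) : ℝ))) *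
          diagSum p m c fun i => (b i).valMinAbs := by
  classical
  set V : ZMod (p ^ m) → ℂ := fun b =>
    dualWeight (complexify Φ) N (b.valMinAbs / ((p ^ m : ℕ) : ℝ))
  have hw : ∀ a : ZMod (p ^ m),
      ((∑' x : ℤ, if (x : ZMod (p ^ m)) = a then Φ (x / N) else 0 : ℝ) : ℂ) =
        ∑ b : ZMod (p ^ m), (N / (p : ℂ) ^ m * V b) * ZMod.stdAddChar (a * b) := by
    intro a
    rw [Complex.ofReal_tsum]
    refine Eq.trans ?_ ((tsum_residue_class_eq (complexify Φ) hN a).trans ?_)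
    · refine tsum_congr fun x => ?_
      split_ifs <;> simp [complexify_apply]
    · simp only [Nat.cast_pow, V]
  have hd : ∀ b : Fin n → ZMod (p ^ m), (diagSum p m c fun i => (b i).valMinAbs) =
      ∑ a ∈ primZeros fun i => (c i : ZMod (p ^ m)), ZMod.stdAddChar (∑ i, a i * b i) := by
    intro b
    simp only [diagSum, primSum, ZMod.coe_valMinAbs]
  rw [weightedCount, (hasSum_boxWeight hm c hΦ hN).tsum_eq, Complex.ofReal_sum, Finset.mul_sum]
  simp only [hd, Complex.ofReal_prod, hw, Finset.mul_sum]
  rw [Finset.sum_comm]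
  refine Finset.sum_congr rfl fun a _ => ?_
  rw [Finset.prod_univ_sum, Fintype.piFinset_univ]
  refine Finset.sum_congr rfl fun b _ => ?_
  rw [addChar_map_sum, Finset.prod_mul_distrib, Finset.prod_mul_distrib, Finset.prod_const,
    Finset.card_univ, Fintype.card_fin]
  ring

theorem card_solutionsModP (c : Fin n → ℤ) :
    (solutionsModP p c).card = (primZeros fun i => (c i : ZMod (p ^ 1))).card := by
  have hp : p.Prime := Fact.out
  have hmem : ∀ x : Fin n → ℤ, x ∈ solutionsModP p c ↔
      (∀ i, 0 ≤ x i ∧ x i < p) ∧ x ≠ 0 ∧ diagForm c x ≡ 0 [ZMOD p] := by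
    intro x
    rw [solutionsModP, Finset.mem_filter, Fintype.mem_piFinset]
    simp only [Finset.mem_Icc, Int.le_sub_one_iff]
  have hiff : ∀ x : Fin n → ℤ, (∀ i, 0 ≤ x i ∧ x i < p) → (x ∈ solutionsModP p c ↔
      (fun i => (x i : ZMod (p ^ 1))) ∈ primZeros fun i => (c i : ZMod (p ^ 1))) := by
    intro x hx
    rw [← mem_congruenceSolutions_iff one_ne_zero, hmem, and_iff_right hx, congruenceSolutions,
      Set.mem_ofPred_eq, pow_one]
    refine and_congr_left' (not_congr ⟨fun h i => h ▸ Int.ModEq.refl _, fun h => ?_⟩)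
    funext i
    exact Int.eq_zero_of_dvd_of_nonneg_of_lt (hx i).1 (hx i).2 (Int.modEq_zero_iff_dvd.mp (h i))
  refine Finset.card_bij (fun x _ i => (x i : ZMod (p ^ 1))) ?_ ?_ ?_
  · intro x hx
    exact (hiff x ((hmem x).mp hx).1).mp hx
  · intro x hx y hy h
    have hx' := ((hmem x).mp hx).1
    have hy' := ((hmem y).mp hy).1
    funext i
    have h1 := (ZMod.intCast_eq_intCast_iff _ _ _).mp (congrFun h i)
    rw [pow_one] at h1
    rw [Int.ModEq, Int.emod_eq_of_lt (hx' i).1 (hx' i).2,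
      Int.emod_eq_of_lt (hy' i).1 (hy' i).2] at h1
    exact h1
  · intro a ha
    have hlt : ∀ i, 0 ≤ ((a i).val : ℤ) ∧ ((a i).val : ℤ) < p := fun i =>
      ⟨Int.natCast_nonneg _, by exact_mod_cast (ZMod.val_lt (a i)).trans_eq (pow_one p)⟩
    have hcast : (fun i => (((a i).val : ℤ) : ZMod (p ^ 1))) = a := by
      funext i
      rw [Int.cast_natCast, ZMod.natCast_zmod_val]
    refine ⟨fun i => (a i).val, ?_, hcast⟩
    rw [hiff _ hlt, hcast]
    exact ha

/-- Over the field with `p` elements `c 0 * a ^ 2 + c 1 * b ^ 2 + c 2 = 0` is solvable, and the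
third coordinate `1` makes the zero primitive. -/
theorem primZeros_nonempty (hn : 3 ≤ n) (hp2 : p ≠ 2) {c : Fin n → ℤ}
    (hc : ∀ i, ¬ (p : ℤ) ∣ c i) :
    (primZeros fun i => (c i : ZMod (p ^ 1))).Nonempty := by
  obtain ⟨l, rfl⟩ := Nat.exists_eq_add_of_le' hn
  have hc0 : ∀ i, (c i : ZMod p) ≠ 0 := fun i h => hc i ((ZMod.intCast_zmod_eq_zero_iff_dvd _ _).mp h)
  open Polynomial in
  obtain ⟨a, b, hab⟩ := FiniteField.exists_root_sum_quadratic (R := ZMod p)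
    (f := C (c 0 : ZMod p) * X ^ 2 + C 0 * X + C 0)
    (g := C (c 1 : ZMod p) * X ^ 2 + C 0 * X + C (c 2 : ZMod p))
    (degree_quadratic (hc0 0)) (degree_quadratic (hc0 1))
    (by rw [ZMod.card]; exact ((Fact.out : p.Prime).eq_two_or_odd).resolve_left hp2)
  simp at hab
  refine ⟨_, (mem_congruenceSolutions_iff (p := p) (m := 1) one_ne_zero (c := c)
    (x := Fin.cons a.val (Fin.cons b.val (Fin.cons 1 fun _ => 0)))).mp ⟨?_, ?_⟩⟩
  · intro h
    have h2 := Int.modEq_zero_iff_dvd.mp (h 2)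
    have h3 : (p : ℤ) ∣ 1 := h2
    have := Int.eq_one_of_dvd_one (by positivity) h3
    exact (Fact.out : p.Prime).one_lt.ne' (by exact_mod_cast this)
  · rw [pow_one, Int.modEq_zero_iff_dvd, ← ZMod.intCast_zmod_eq_zero_iff_dvd, diagForm]
    push_cast
    rw [Fin.sum_univ_succ, Fin.sum_univ_succ, Fin.sum_univ_succ]
    simp
    have h2 : (Fin.cons a.cast (Fin.cons b.cast (Fin.cons 1 fun _ => 0)) : Fin (l + 3) → ℤ) 2 = 1 :=
      rfl
    rw [h2]
    simpa using hab

/-- This is the zero-frequency term of `weightedCount_eq_sum` with the dual weight replaced by its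
limit as `N` grows. -/
theorem mainTerm_eq (hp2 : Odd p) (hn : 1 ≤ n) (hm : m ≠ 0) {c : Fin n → ℤ}
    (hc : ∀ i, ¬ (p : ℤ) ∣ c i) (Φ : 𝓢(ℝ, ℝ)) (N : ℝ) :
    mainTerm p m c Φ N =
      ((N : ℂ) / (p : ℂ) ^ m) ^ n * ((𝓕 (complexify Φ) 0) ^ n * diagSum p m c 0) := by
  obtain ⟨k, rfl⟩ := Nat.exists_eq_succ_of_ne_zero hm
  obtain ⟨l, rfl⟩ := Nat.exists_eq_add_of_le' hn
  have hp : (p : ℂ) ≠ 0 := Nat.cast_ne_zero.mpr (Fact.out : p.Prime).ne_zero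
  rw [Nat.succ_eq_add_one, diagSum_zero hp2 k hc, mainTerm, solutionDensity, card_solutionsModP,
    show (𝓕 (fun x : ℝ => (Φ x : ℂ)) 0) = 𝓕 (complexify Φ) 0 from rfl, Nat.add_sub_cancel]
  push_cast
  rw [div_pow, div_mul_eq_mul_div, div_mul_div_comm, div_mul_eq_mul_div,
    div_eq_div_iff (by simp [hp]) (by simp [hp])]
  ring

/-- A relative error bound uniform in `c` needs a uniform lower bound for the main term; one
primitive zero modulo `p` and its lifts supply it. -/
theorem norm_diagSum_zero_ge (hp2 : Odd p) (hn : 3 ≤ n) (hm : m ≠ 0) {c : Fin n → ℤ}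
    (hc : ∀ i, ¬ (p : ℤ) ∣ c i) :
    ((p : ℝ) ^ m) ^ (n - 1) / (p : ℝ) ^ (n - 1) ≤ ‖diagSum p m c 0‖ := by
  obtain ⟨k, rfl⟩ := Nat.exists_eq_succ_of_ne_zero hm
  have hp : 0 < (p : ℝ) := Nat.cast_pos.mpr (Fact.out : p.Prime).pos
  have h1 : (1 : ℝ) ≤ (primZeros fun i => (c i : ZMod (p ^ 1))).card := by
    exact_mod_cast Finset.card_pos.mpr (primZeros_nonempty hn
      (by rintro rfl; exact absurd hp2 (by decide)) hc)
  rw [Nat.succ_eq_add_one, diagSum_zero hp2 k hc, norm_mul, norm_pow, norm_pow,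
    Complex.norm_natCast, Complex.norm_natCast, div_le_iff₀ (by positivity)]
  calc ((p : ℝ) ^ (k + 1)) ^ (n - 1) = ((p : ℝ) ^ (n - 1)) ^ k * 1 * (p : ℝ) ^ (n - 1) := by ring
    _ ≤ _ := by gcongr

/-- The contribution of the nonzero dual frequencies is of lower order. -/
theorem exists_sum_nonzero_frequencies_le (hp2 : Odd p) (hn : 4 ≤ n) {ε κ : ℝ} (hε : 0 < ε)
    (hκ : 0 < κ) (f : 𝓢(ℝ, ℂ)) :
    ∃ m₀ : ℕ, ∀ m : ℕ, m₀ ≤ m → ∀ c : Fin n → ℤ, (∀ i, ¬ (p : ℤ) ∣ c i) →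
      ∀ N : ℝ, ((p : ℝ) ^ m) ^ (1 / 2 + ε) ≤ N →
      ∑ b : Fin n → ZMod (p ^ m) with b ≠ 0,
        ‖(∏ i, dualWeight f N ((b i).valMinAbs / ((p ^ m : ℕ) : ℝ))) *
          diagSum p m c fun i => (b i).valMinAbs‖ ≤ κ * ((p : ℝ) ^ m) ^ (n - 1) := by
  classical
  have hp1 : (1 : ℝ) < p := by exact_mod_cast (Fact.out : p.Prime).one_lt
  -- Beyond `T` the weight decays like `q ^ (-(ε / 2) * L)`, and this `L` makes that at most `q ^
  -- (-(n + 2))`.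
  obtain ⟨L, hL⟩ := exists_nat_ge (2 * (n + 2) / ε)
  obtain ⟨C, hC, hV⟩ := exists_norm_dualWeight_le f L
  obtain ⟨m₁, hm₁⟩ := exists_sum_norm_diagSum_le (p := p) hp2 hn hε
    (show 0 < κ / 2 / C ^ n by positivity)
  obtain ⟨m₂, hm₂⟩ := pow_unbounded_of_one_lt (2 * C ^ n / κ) hp1
  refine ⟨max m₁ m₂, fun m hm c hc N hN => ?_⟩
  specialize hm₁ m ((le_max_left _ _).trans hm) c hc
  set q : ℝ := (p : ℝ) ^ m with hq
  have hq1 : 1 ≤ q := one_le_pow₀ hp1.le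
  have hq0 : 0 < q := by linarith
  have hqC : C ^ n ≤ κ / 2 * q := by
    have h1 : 2 * C ^ n / κ ≤ q :=
      hm₂.le.trans (pow_le_pow_right₀ hp1.le ((le_max_right _ _).trans hm))
    rw [div_le_iff₀ hκ] at h1
    linarith
  have hN1 : 1 ≤ N := (Real.one_le_rpow hq1 (by linarith)).trans hN
  set T : ℝ := q ^ (1 / 2 - ε / 2) with hT
  set V : ZMod (p ^ m) → ℂ := fun b => dualWeight f N (b.valMinAbs / ((p ^ m : ℕ) : ℝ)) with hVdef
  set G : (Fin n → ZMod (p ^ m)) → ℂ := fun b => diagSum p m c fun i => (b i).valMinAbs with hG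
  have hqc : ((p ^ m : ℕ) : ℝ) = q := by rw [hq]; push_cast; rfl
  have hθ : ∀ b : ZMod (p ^ m), |(b.valMinAbs : ℝ) / ((p ^ m : ℕ) : ℝ)| ≤ 1 / 2 := by
    intro b
    have h1 := ZMod.natAbs_valMinAbs_le b
    have h2 : 2 * b.valMinAbs.natAbs ≤ p ^ m := by omega
    have h3 : 2 * |(b.valMinAbs : ℝ)| ≤ q := by
      rw [← hqc]
      have : ((b.valMinAbs.natAbs : ℕ) : ℝ) = |(b.valMinAbs : ℝ)| := by
        rw [Nat.cast_natAbs]; push_cast; rfl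
      rw [← this]
      exact_mod_cast h2
    rw [abs_div, hqc, abs_of_pos hq0, div_le_iff₀ hq0]
    linarith
  have hVC : ∀ b, ‖V b‖ ≤ C := fun b =>
    (le_mul_of_one_le_right (norm_nonneg _) (one_le_pow₀ (by
      have : 0 ≤ N * |(b.valMinAbs : ℝ) / ((p ^ m : ℕ) : ℝ)| := by positivity
      linarith))).trans (hV N _ hN1 (hθ b))
  have hVsmall : ∀ b : ZMod (p ^ m), T < |(b.valMinAbs : ℝ)| → ‖V b‖ ≤ C * (q ^ (n + 2))⁻¹ := by
    intro b hb
    have h1 : q ^ (ε / 2) ≤ 1 + N * |(b.valMinAbs : ℝ) / ((p ^ m : ℕ) : ℝ)| := by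
      rw [abs_div, hqc, abs_of_pos hq0]
      calc q ^ (ε / 2) = q ^ (1 / 2 + ε) * (T / q) := by
            rw [hT, ← Real.rpow_sub_one hq0.ne', ← Real.rpow_add hq0]
            congr 1
            ring
        _ ≤ N * (|(b.valMinAbs : ℝ)| / q) := by gcongr
        _ ≤ _ := by linarith
    have h2 : q ^ (n + 2) ≤ (1 + N * |(b.valMinAbs : ℝ) / ((p ^ m : ℕ) : ℝ)|) ^ L := by
      calc q ^ (n + 2) = q ^ ((n + 2 : ℕ) : ℝ) := (Real.rpow_natCast _ _).symm
        _ ≤ q ^ (ε / 2 * L) := by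
            refine Real.rpow_le_rpow_of_exponent_le hq1 ?_
            rw [div_le_iff₀ hε] at hL
            push_cast
            linarith
        _ = (q ^ (ε / 2)) ^ L := by rw [Real.rpow_mul hq0.le, Real.rpow_natCast]
        _ ≤ _ := pow_le_pow_left₀ (by positivity) h1 _
    rw [← div_eq_mul_inv, le_div_iff₀ (by positivity)]
    exact (mul_le_mul_of_nonneg_left h2 (norm_nonneg _)).trans (hV N _ hN1 (hθ b))
  rw [← Finset.sum_filter_add_sum_filter_not _ (fun b => ∀ i, |((b i).valMinAbs : ℝ)| ≤ T)]
  have hsmall : ∑ b ∈ (Finset.univ.filter fun b : Fin n → ZMod (p ^ m) => b ≠ 0) with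
      ∀ i, |((b i).valMinAbs : ℝ)| ≤ T, ‖(∏ i, V (b i)) * G b‖ ≤ κ / 2 * q ^ (n - 1) := by
    set S := (Finset.univ.filter fun b : Fin n → ZMod (p ^ m) => b ≠ 0).filter fun b =>
      ∀ i, |((b i).valMinAbs : ℝ)| ≤ T
    have hinj : Set.InjOn (fun (b : Fin n → ZMod (p ^ m)) i => (b i).valMinAbs) S := by
      intro b _ b' _ h
      funext i
      exact ZMod.injective_valMinAbs (congrFun h i)
    have h1 := hm₁ (S.image fun b i => (b i).valMinAbs) (by
      intro B hB
      obtain ⟨b, hb, rfl⟩ := Finset.mem_image.mp hB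
      simp only [S, Finset.mem_filter, Finset.mem_univ, true_and] at hb
      refine ⟨fun h => hb.1 ?_, hb.2⟩
      funext i
      exact (ZMod.valMinAbs_eq_zero _).mp (congrFun h i))
    rw [Finset.sum_image hinj] at h1
    calc _ ≤ ∑ b ∈ S, C ^ n * ‖G b‖ := by
          refine Finset.sum_le_sum fun b _ => ?_
          rw [norm_mul, norm_prod]
          gcongr
          refine (Finset.prod_le_prod (fun _ _ => norm_nonneg _) fun i _ => hVC (b i)).trans ?_
          rw [Finset.prod_const, Finset.card_univ, Fintype.card_fin]
      _ = C ^ n * ∑ b ∈ S, ‖G b‖ := (Finset.mul_sum _ _ _).symm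
      _ ≤ C ^ n * (κ / 2 / C ^ n * q ^ (n - 1)) := by gcongr
      _ = _ := by field_simp
  -- At most `q ^ n` frequencies, each with the trivial bound `q ^ n` for `diagSum`, leave `C ^ n *
  -- q ^ (n - 2)` in total.
  have hlarge : ∑ b ∈ (Finset.univ.filter fun b : Fin n → ZMod (p ^ m) => b ≠ 0) with
      ¬ ∀ i, |((b i).valMinAbs : ℝ)| ≤ T, ‖(∏ i, V (b i)) * G b‖ ≤ κ / 2 * q ^ (n - 1) := by
    have hterm : ∀ b : Fin n → ZMod (p ^ m), (¬ ∀ i, |((b i).valMinAbs : ℝ)| ≤ T) →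
        ‖(∏ i, V (b i)) * G b‖ ≤ C ^ n * (q ^ (n + 2))⁻¹ * q ^ n := by
      intro b hb
      push Not at hb
      obtain ⟨i₀, hi₀⟩ := hb
      rw [norm_mul, norm_prod]
      have hGle : ‖G b‖ ≤ q ^ n := by
        refine (norm_primSum_le _ _ _).trans_eq ?_
        rw [ZMod.card, hqc]
      refine mul_le_mul ?_ hGle (norm_nonneg _) (by positivity)
      calc ∏ i, ‖V (b i)‖ ≤ ∏ i : Fin n, C * (if i = i₀ then (q ^ (n + 2))⁻¹ else 1) := by
            refine Finset.prod_le_prod (fun _ _ => norm_nonneg _) fun i _ => ?_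
            split_ifs with h
            · rw [h]; exact hVsmall _ hi₀
            · rw [mul_one]; exact hVC _
        _ = _ := by
            rw [Finset.prod_mul_distrib, Finset.prod_const, Finset.card_univ, Fintype.card_fin,
              Finset.prod_ite_eq' Finset.univ i₀, if_pos (Finset.mem_univ _)]
    calc _ ≤ ∑ b ∈ (Finset.univ.filter fun b : Fin n → ZMod (p ^ m) => b ≠ 0) with
          ¬ ∀ i, |((b i).valMinAbs : ℝ)| ≤ T, C ^ n * (q ^ (n + 2))⁻¹ * q ^ n :=
          Finset.sum_le_sum fun b hb => hterm b (Finset.mem_filter.mp hb).2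
      _ ≤ ∑ b : Fin n → ZMod (p ^ m), C ^ n * (q ^ (n + 2))⁻¹ * q ^ n :=
          Finset.sum_le_sum_of_subset_of_nonneg (Finset.subset_univ _) fun _ _ _ => by positivity
      _ = q ^ n * (C ^ n * (q ^ (n + 2))⁻¹ * q ^ n) := by
          rw [Finset.sum_const, Finset.card_univ, Fintype.card_fun, Fintype.card_fin, ZMod.card,
            nsmul_eq_mul, Nat.cast_pow, hqc]
      _ ≤ q ^ n * ((κ / 2 * q) * (q ^ (n + 2))⁻¹ * q ^ n) := by gcongr
      _ = _ := by
          obtain ⟨l, rfl⟩ := Nat.exists_eq_add_of_le' (show 1 ≤ n by omega)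
          rw [Nat.add_sub_cancel]
          field_simp
          ring
  linarith

end Assembly

/-! ### The asymptotic formula and small solutions. -/

section Asymptotic

variable {p n : ℕ} [Fact p.Prime]

theorem fourier_complexify_zero (Φ : 𝓢(ℝ, ℝ)) : 𝓕 (complexify Φ) 0 = ((∫ x, Φ x : ℝ) : ℂ) := by
  rw [SchwartzMap.fourier_coe, Real.fourier_real_eq_integral_exp_smul, ← integral_complex_ofReal]
  simp [complexify_apply]

theorem eq_zero_of_fourier_zero_eq_zero {Φ : 𝓢(ℝ, ℝ)} (hΦ : ∀ t, 0 ≤ Φ t)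
    (h : 𝓕 (complexify Φ) 0 = 0) (t : ℝ) : Φ t = 0 := by
  rw [fourier_complexify_zero, Complex.ofReal_eq_zero,
    MeasureTheory.integral_eq_zero_iff_of_nonneg hΦ Φ.integrable] at h
  exact congrFun (MeasureTheory.Measure.eq_of_ae_eq h Φ.continuous continuous_const) t

theorem exists_norm_weightedCount_sub_mainTerm_le (hp2 : Odd p) (hn : 4 ≤ n) {ε δ : ℝ}
    (hε : 0 < ε) (hδ : 0 < δ) {Φ : 𝓢(ℝ, ℝ)} (hΦ : ∀ t, 0 ≤ Φ t) :
    ∃ m₀ : ℕ, ∀ m : ℕ, m₀ ≤ m → ∀ c : Fin n → ℤ, (∀ i, ¬ (p : ℤ) ∣ c i) →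
      ∀ N : ℝ, ((p : ℝ) ^ m) ^ (1 / 2 + ε) ≤ N →
        Summable (fun x : congruenceSolutions p m c => boxWeight Φ N x.1) ∧
        ‖(weightedCount p m c Φ N : ℂ) - mainTerm p m c Φ N‖ ≤ δ * ‖mainTerm p m c Φ N‖ := by
  classical
  have hp1 : (1 : ℝ) < p := by exact_mod_cast (Fact.out : p.Prime).one_lt
  set F := 𝓕 (complexify Φ) 0 with hF
  have hNpos : ∀ m : ℕ, ∀ N : ℝ, ((p : ℝ) ^ m) ^ (1 / 2 + ε) ≤ N → 1 ≤ N := fun m N h =>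
    (Real.one_le_rpow (one_le_pow₀ hp1.le) (by linarith)).trans h
  -- If the integral vanishes, then `Φ` is identically zero and both sides are zero.
  by_cases hF0 : F = 0
  · have h0 := eq_zero_of_fourier_zero_eq_zero hΦ hF0
    refine ⟨1, fun m hm c hc N hN => ⟨?_, ?_⟩⟩
    · exact (hasSum_boxWeight (by omega) c hΦ (by linarith [hNpos m N hN])).summable
    · have h1 : ∀ x : Fin n → ℤ, boxWeight Φ N x = 0 := fun x =>
        Finset.prod_eq_zero (Finset.mem_univ ⟨0, by omega⟩) (h0 _)
      rw [mainTerm_eq hp2 (by omega) (by omega) hc, ← hF, hF0, zero_pow (by omega), zero_mul,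
        mul_zero, weightedCount]
      simp [h1]
  have hFn : 0 < ‖F‖ ^ n := pow_pos (norm_pos_iff.mpr hF0) n
  -- The constant is matched to `norm_diagSum_zero_ge`, so that the nonzero frequencies use half of
  -- `δ`; the other half pays for replacing the zero-frequency weight by `F`.
  obtain ⟨m₁, hm₁⟩ := exists_sum_nonzero_frequencies_le (p := p) hp2 hn hε
    (show 0 < δ / 2 * ‖F‖ ^ n / (p : ℝ) ^ (n - 1) by positivity) (complexify Φ)
  obtain ⟨C, hC, hV0⟩ := exists_norm_dualWeight_zero_sub_le (complexify Φ)
  obtain ⟨η, hη, hcont⟩ := Metric.continuousAt_iff.mp ((continuous_pow n).continuousAt (x := F))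
    (δ / 2 * ‖F‖ ^ n) (by positivity)
  have hlim : Filter.Tendsto (fun m : ℕ => ((p : ℝ) ^ m) ^ (1 / 2 + ε)) Filter.atTop
      Filter.atTop :=
    (tendsto_rpow_atTop (by linarith)).comp (tendsto_pow_atTop_atTop_of_one_lt hp1)
  obtain ⟨m₂, hm₂⟩ := Filter.eventually_atTop.mp (hlim.eventually_gt_atTop (C / η))
  refine ⟨max (max m₁ m₂) 1, fun m hm c hc N hN => ?_⟩
  -- Modulo `p ^ 0` every residue is a unit, so being a unit does not detect primitivity.
  have hm0 : m ≠ 0 := by have := (le_max_right _ _).trans hm; omega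
  have hm12 := (le_max_left _ _).trans hm
  specialize hm₁ m ((le_max_left _ _).trans hm12) c hc N hN
  specialize hm₂ m ((le_max_right _ _).trans hm12)
  have hN1 := hNpos m N hN
  have hN0 : 0 < N := by linarith
  refine ⟨(hasSum_boxWeight hm0 c hΦ hN0).summable, ?_⟩
  have hG := norm_diagSum_zero_ge hp2 (by omega) hm0 hc
  set q : ℝ := (p : ℝ) ^ m with hq
  set V : ZMod (p ^ m) → ℂ := fun b =>
    dualWeight (complexify Φ) N (b.valMinAbs / ((p ^ m : ℕ) : ℝ)) with hV
  set G : (Fin n → ZMod (p ^ m)) → ℂ := fun b => diagSum p m c fun i => (b i).valMinAbs with hGdef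
  have hclose : ‖V 0 ^ n - F ^ n‖ ≤ δ / 2 * ‖F‖ ^ n := by
    have h1 : ‖V 0 - F‖ < η := by
      have h2 : V 0 = dualWeight (complexify Φ) N 0 := by
        simp only [hV, ZMod.valMinAbs_zero, Int.cast_zero, zero_div]
      rw [h2]
      refine (hV0 N hN1).trans_lt ?_
      rw [div_lt_iff₀ hN0, mul_comm]
      have := hm₂.trans_le hN
      rwa [div_lt_iff₀ hη] at this
    have := hcont (x := V 0) (by rwa [dist_eq_norm])
    rw [dist_eq_norm] at this
    exact this.le
  have hsplit : ∑ b : Fin n → ZMod (p ^ m), (∏ i, V (b i)) * G b =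
      V 0 ^ n * diagSum p m c 0 +
        ∑ b : Fin n → ZMod (p ^ m) with b ≠ 0, (∏ i, V (b i)) * G b := by
    rw [← Finset.sum_filter_add_sum_filter_not Finset.univ (fun b => b = 0), Finset.filter_eq',
      if_pos (Finset.mem_univ _), Finset.sum_singleton]
    congr 2
    · simp [Finset.prod_const]
    · simp only [hGdef, Pi.zero_apply, ZMod.valMinAbs_zero]
      rfl
  rw [weightedCount_eq_sum hm0 c hΦ hN0, mainTerm_eq hp2 (by omega) hm0 hc, ← mul_sub, norm_mul,
    norm_mul, ← mul_left_comm]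
  refine mul_le_mul_of_nonneg_left ?_ (norm_nonneg _)
  change ‖∑ b : Fin n → ZMod (p ^ m), (∏ i, V (b i)) * G b - F ^ n * diagSum p m c 0‖ ≤ _
  rw [hsplit, show V 0 ^ n * diagSum p m c 0 +
      ∑ b : Fin n → ZMod (p ^ m) with b ≠ 0, (∏ i, V (b i)) * G b - F ^ n * diagSum p m c 0 =
      (V 0 ^ n - F ^ n) * diagSum p m c 0 +
      ∑ b : Fin n → ZMod (p ^ m) with b ≠ 0, (∏ i, V (b i)) * G b by ring]
  calc _ ≤ ‖V 0 ^ n - F ^ n‖ * ‖diagSum p m c 0‖ +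
        ∑ b : Fin n → ZMod (p ^ m) with b ≠ 0, ‖(∏ i, V (b i)) * G b‖ := by
        refine (norm_add_le _ _).trans ?_
        rw [norm_mul]
        gcongr
        exact norm_sum_le _ _
    _ ≤ δ / 2 * ‖F‖ ^ n * ‖diagSum p m c 0‖ +
        δ / 2 * ‖F‖ ^ n / (p : ℝ) ^ (n - 1) * q ^ (n - 1) := by gcongr
    _ = δ / 2 * ‖F‖ ^ n * ‖diagSum p m c 0‖ +
        δ / 2 * ‖F‖ ^ n * (q ^ (n - 1) / (p : ℝ) ^ (n - 1)) := by ring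
    _ ≤ δ / 2 * ‖F‖ ^ n * ‖diagSum p m c 0‖ + δ / 2 * ‖F‖ ^ n * ‖diagSum p m c 0‖ := by gcongr
    _ = δ * ‖F ^ n * diagSum p m c 0‖ := by rw [norm_mul, norm_pow]; ring

theorem mainTerm_ne_zero (hp2 : Odd p) (hn : 3 ≤ n) {m : ℕ} (hm : m ≠ 0) {c : Fin n → ℤ}
    (hc : ∀ i, ¬ (p : ℤ) ∣ c i) {Φ : 𝓢(ℝ, ℝ)} (hΦ : 0 < ∫ x, Φ x) {N : ℝ} (hN : 0 < N) :
    mainTerm p m c Φ N ≠ 0 := by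
  have hp0 : (0 : ℝ) < p := Nat.cast_pos.mpr (Fact.out : p.Prime).pos
  have hpc : (p : ℂ) ≠ 0 := Nat.cast_ne_zero.mpr (Fact.out : p.Prime).ne_zero
  have hNc : (N : ℂ) ≠ 0 := Complex.ofReal_ne_zero.mpr hN.ne'
  rw [mainTerm_eq hp2 (by omega) hm hc, fourier_complexify_zero]
  refine mul_ne_zero (pow_ne_zero _ (div_ne_zero hNc (pow_ne_zero _ hpc)))
    (mul_ne_zero (pow_ne_zero _ (Complex.ofReal_ne_zero.mpr hΦ.ne')) ?_)
  rw [← norm_pos_iff]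
  exact lt_of_lt_of_le (by positivity) (norm_diagSum_zero_ge hp2 hn hm hc)

/-- A nonnegative Schwartz function with positive integral, supported in `[-1, 1]`. -/
theorem exists_schwartz_supported :
    ∃ Φ : 𝓢(ℝ, ℝ), (∀ t, 0 ≤ Φ t) ∧ (0 < ∫ x, Φ x) ∧ ∀ t, Φ t ≠ 0 → |t| ≤ 1 := by
  let f : ContDiffBump (0 : ℝ) := ⟨1 / 2, 1, by norm_num, by norm_num⟩
  refine ⟨f.hasCompactSupport.toSchwartzMap f.contDiff, fun t => f.nonneg, ?_, fun t ht => ?_⟩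
  · exact f.integral_pos
  · have h : t ∈ Function.support f := ht
    rw [f.support_eq, mem_ball_zero_iff] at h
    exact h.le

end Asymptotic

theorem not_dvd_of_isCoprime_prod {p n : ℕ} (hp : p.Prime) {c : Fin n → ℤ}
    (hc : IsCoprime (∏ i, c i) (p : ℤ)) (i : Fin n) : ¬ (p : ℤ) ∣ c i := by
  intro h
  exact (Nat.prime_iff_prime_int.mp hp).not_isUnit
    (hc.isUnit_of_dvd' (h.trans (Finset.dvd_prod_of_mem c (Finset.mem_univ i))) dvd_rfl)

theorem theorem2 (ε : ℝ) (hε : 0 < ε) (n : ℕ) (hn : 4 ≤ n) (p : ℕ) (hp : p.Prime) (hp3 : 3 ≤ p) :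
    (∀ Φ : 𝓢(ℝ, ℝ), (∀ t, 0 ≤ Φ t) →
      ∀ δ : ℝ, 0 < δ → ∃ m₀ : ℕ, ∀ m : ℕ, m₀ ≤ m →
        ∀ c : Fin n → ℤ, IsCoprime (∏ i, c i) (p : ℤ) →
          ∀ N : ℝ, ((p : ℝ) ^ m) ^ (1 / 2 + ε) ≤ N →
            Summable (fun x : congruenceSolutions p m c => boxWeight Φ N x.1) ∧
            ‖(weightedCount p m c Φ N : ℂ) - mainTerm p m c Φ N‖ ≤ δ * ‖mainTerm p m c Φ N‖) ∧
    (∃ m₀ : ℕ, ∀ m : ℕ, m₀ ≤ m →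
      ∀ c : Fin n → ℤ, IsCoprime (∏ i, c i) (p : ℤ) →
        ∃ x : Fin n → ℤ, ¬ (∀ i, x i ≡ 0 [ZMOD p]) ∧
          diagForm c x ≡ 0 [ZMOD (p : ℤ) ^ m] ∧
          ∀ i, |(x i : ℝ)| ≤ ((p : ℝ) ^ m) ^ (1 / 2 + ε)) := by
  have : Fact p.Prime := ⟨hp⟩
  have hp2 : Odd p := hp.odd_of_ne_two (by omega)
  constructor
  · intro Φ hΦ δ hδ
    obtain ⟨m₀, h⟩ := exists_norm_weightedCount_sub_mainTerm_le (p := p) hp2 hn hε hδ hΦ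
    exact ⟨m₀, fun m hm c hc => h m hm c (not_dvd_of_isCoprime_prod hp hc)⟩
  · obtain ⟨Φ, hΦ, hpos, hsupp⟩ := exists_schwartz_supported
    obtain ⟨m₀, h⟩ := exists_norm_weightedCount_sub_mainTerm_le (p := p) hp2 hn hε one_half_pos hΦ
    refine ⟨max m₀ 1, fun m hm c hc => ?_⟩
    have hm1 : m ≠ 0 := by have := (le_max_right _ _).trans hm; omega
    have hc' := not_dvd_of_isCoprime_prod hp hc
    set N : ℝ := ((p : ℝ) ^ m) ^ (1 / 2 + ε)
    have hN : 0 < N := by positivity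
    obtain ⟨-, hle⟩ := h m ((le_max_left _ _).trans hm) c hc' N le_rfl
    by_contra! hcon
    -- Without a solution in the box, every solution has a coordinate where the bump vanishes. The
    -- count is then zero, against a relative error of at most one half of a nonzero main term.
    have h0 : ∀ x : congruenceSolutions p m c, boxWeight Φ N x.1 = 0 := by
      rintro ⟨x, hx⟩
      obtain ⟨i, hi⟩ := hcon x (not_forall.mp hx.1) hx.2
      refine Finset.prod_eq_zero (Finset.mem_univ i) ?_
      by_contra hne
      have := hsupp _ hne
      rw [abs_div, abs_of_pos hN, div_le_one hN] at this
      linarith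
    have hw : weightedCount p m c Φ N = 0 := by
      rw [weightedCount, tsum_congr h0, tsum_zero]
    rw [hw, Complex.ofReal_zero, zero_sub, norm_neg] at hle
    have := norm_pos_iff.mpr (mainTerm_ne_zero hp2 (by omega) hm1 hc' hpos hN)
    linarith
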